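/- A *dagger prop* is a strict symmetric monoidal dagger category whose objects are the natural numbers, with tensor product of objects given by addition and with unitary braiding; write $+$ for the tensor product of morphisms and $B_{m,n}\colon m+n\to n+m$ for the braiding. A *morphism of dagger props* is a strict symmetric monoidal functor that is the identity on objects and commutes with the daggers. *Bond graphs.* Let $\mathrm{BondGraph}$ be the prop generated by morphisms $M\colon 2\to 1$, $I\colon 0\to 1$, $D\colon 1\to 2$, $E\colon 1\to 0$ (1-junctions) and $M'\colon 2\to 1$, $I'\colon 0\to 1$, $D'\colon 1\to 2$, $E'\colon 1\to 0$ (0-junctions), subject to the following equations. - $(1,M,I,D,E)$ and $(1,M',I',D',E')$ are extraspecial symmetric Frobenius monoids. Here $(1,\mu,\iota,\delta,\epsilon)$ is such if $(1,\mu,\iota)$ is a monoid, $(1,\delta,\epsilon)$ is a comonoid, $(\mathrm{id}_1+\mu)(\delta+\mathrm{id}_1)=\delta\mu=(\mu+\mathrm{id}_1)(\mathrm{id}_1+\delta)$, $\mu\delta=\mathrm{id}_1$, $\epsilon\iota=\mathrm{id}_0$ and $\epsilon\mu B_{1,1}=\epsilon\mu$ (equivalently $B_{1,1}\delta\iota=\delta\iota$).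 - $(1,M,I,D',E')$ and $(1,M',I',D,E)$ are weak bimonoids. Here a monoid $(1,\mu,\iota)$ and a comonoid $(1,\delta,\epsilon)$ form a weak bimonoid if $$\delta\mu=(\mu+\mu)(\mathrm{id}_1+B_{1,1}+\mathrm{id}_1)(\delta+\delta),$$ $$\epsilon\mu(\mu+\mathrm{id}_1)=(\epsilon\mu+\epsilon\mu)(\mathrm{id}_1+\delta+\mathrm{id}_1)=(\epsilon\mu+\epsilon\mu)(\mathrm{id}_1+B_{1,1}\delta+\mathrm{id}_1),$$ $$(\delta+\mathrm{id}_1)\delta\iota=(\mathrm{id}_1+\mu+\mathrm{id}_1)(\delta\iota+\delta\iota)=(\mathrm{id}_1+\mu B_{1,1}+\mathrm{id}_1)(\delta\iota+\delta\iota).$$ - $EI'=\mathrm{id}_0=E'I$. - $(M'DMD')^2=M'DMD'$ and $(MD'M'D)^2=MD'M'D$. It is a dagger prop with the dagger determined by $M^\dagger=D$, $I^\dagger=E$, $M'^\dagger=D'$, $I'^\dagger=E'$. *Corelations.* Let $\mathrm{FinCorel}$ be the dagger prop in which a morphism $m\to n$ is a partition of the disjoint union of an $m$-element set and an $n$-element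 set. Partitions are composed by gluing along the middle set (taking the finest common coarsening) and restricting to the outer sets, the tensor product is disjoint union, the braiding is the block swap, and the dagger exchanges source and target. Let $m\colon 2\to 1$, $i\colon 0\to 1$, $d\colon 1\to 2$, $e\colon 1\to 0$ be the partitions with a single part, and put $$m_2=\mathrm{id}_1+em+\mathrm{id}_1,\quad i_2=di,\quad d_2=\mathrm{id}_1+di+\mathrm{id}_1,\quad e_2=em,$$ $$\mu_2=(m+m)(\mathrm{id}_1+B_{1,1}+\mathrm{id}_1),\quad \iota_2=i+i,\quad \delta_2=(\mathrm{id}_1+B_{1,1}+\mathrm{id}_1)(d+d),\quad \epsilon_2=e+e.$$ These are two Frobenius structures on the object $2$. Let $\mathrm{FinCorel}^\circ$ be the symmetric monoidal dagger subcategory of $\mathrm{FinCorel}$ with objects $0,2,4,\dots$ generated by these eight morphisms. It is regarded as a dagger prop by calling the object $2n$ by the name $n$. *Lagrangian relations.* Let $k$ be a field. Let $\mathrm{LagRel}_k$ be the dagger prop in which a morphism $m\to n$ is a Lagrangian (that is, maximal isotropic) subspace of $\overline{(k\oplus k)^m}\oplus(k\oplus k)^n$. Here $(k\oplus k)^n$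 carries the sum of $n$ copies of the form $\omega((\phi,J),(\phi',J'))=\phi J'-\phi'J$, and the bar denotes the sign change of the form. Composition is relational composition, the tensor product is direct sum, the braiding is the block swap, and the dagger is the opposite relation. Consider the linear relations $+\colon k\oplus k\to k$ (addition), $0\colon\{0\}\to k$ (zero), $\Delta\colon k\to k\oplus k$ (duplication), $!\colon k\to\{0\}$ (deletion) and their opposites, marked by $\dagger$. For linear relations $R,S$ from $k^m$ to $k^n$, let $R\oplus S$ be the relation from $(k\oplus k)^m$ to $(k\oplus k)^n$ that relates the first components (efforts) by $R$ and the second components (flows) by $S$. Let $\mathrm{LagRel}_k^\circ$ be the sub-prop of $\mathrm{LagRel}_k$ generated by $+\oplus\Delta^\dagger$, $0\oplus{!}^\dagger$, $+^\dagger\oplus\Delta$, $0^\dagger\oplus{!}$, $\Delta^\dagger\oplus+$, ${!}^\dagger\oplus 0$, $\Delta\oplus+^\dagger$ and ${!}\oplus 0^\dagger$, with the dagger of $\mathrm{LagRel}_k$. **Proposition.** There is a unique morphism of dagger props $G\colon\mathrm{BondGraph}\to\mathrm{FinCorel}^\circ$ with $$G(M)=m_2,\quad G(I)=i_2,\quad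 G(M')=\mu_2,\quad G(I')=\iota_2,$$ and, for every field $k$, there is a unique morphism of dagger props $F\colon\mathrm{BondGraph}\to\mathrm{LagRel}_k^\circ$ with $$F(M)=+\oplus\Delta^\dagger,\quad F(I)=0\oplus{!}^\dagger,\quad F(M')=\Delta^\dagger\oplus+,\quad F(I')={!}^\dagger\oplus 0.$$ -/

import Mathlib

/-!
Conventions.  `comp f g` is written in diagrammatic order: first `f`, then `g`, so it is the
composite `g ∘ f`.
-/

universe u v

namespace BondGraphs

/-! ### Dagger props -/

/-- The operations of a dagger prop: a category whose objects are the natural numbers, with a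
tensor product that is addition on objects, a braiding and a dagger. -/
structure DaggerPropData where
  Hom : ℕ → ℕ → Type u
  id : ∀ n, Hom n n
  comp : ∀ {m n p}, Hom m n → Hom n p → Hom m p
  tensor : ∀ {m n p q}, Hom m n → Hom p q → Hom (m + p) (n + q)
  braid : ∀ m n, Hom (m + n) (n + m)
  dagger : ∀ {m n}, Hom m n → Hom n m

/-- Transport of a morphism along equalities between its source, resp. target, objects. -/
def DaggerPropData.cast (P : DaggerPropData.{u}) {m n m' n' : ℕ} (h : m = m') (h' : n = n')
    (f : P.Hom m n) : P.Hom m' n' := h ▸ h' ▸ f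

/-- A dagger prop: a strict symmetric monoidal dagger category with objects the natural numbers
and tensor product of objects given by addition.  Strictness means that associators and unitors
are identities, i.e. that the two sides of `tensor_assoc`, `id_tensor`, `tensor_id_zero` agree
after transport along the equalities `m + n + p = m + (n + p)`, `0 + m = m`, `m + 0 = m` of
objects. -/
structure DaggerProp extends DaggerPropData.{u} where
  id_comp : ∀ {m n} (f : Hom m n), comp (id m) f = f
  comp_id : ∀ {m n} (f : Hom m n), comp f (id n) = f
  comp_assoc : ∀ {m n p q} (f : Hom m n) (g : Hom n p) (h : Hom p q),
    comp (comp f g) h = comp f (comp g h)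
  id_tensor_id : ∀ m n, tensor (id m) (id n) = id (m + n)
  interchange : ∀ {m n p m' n' p'} (f : Hom m n) (g : Hom n p) (f' : Hom m' n') (g' : Hom n' p'),
    tensor (comp f g) (comp f' g') = comp (tensor f f') (tensor g g')
  tensor_assoc : ∀ {m n p q r s} (f : Hom m n) (g : Hom p q) (h : Hom r s),
    toDaggerPropData.cast (Nat.add_assoc m p r) (Nat.add_assoc n q s) (tensor (tensor f g) h)
      = tensor f (tensor g h)
  id_tensor : ∀ {m n} (f : Hom m n),
    toDaggerPropData.cast (Nat.zero_add m) (Nat.zero_add n) (tensor (id 0) f) = f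
  tensor_id_zero : ∀ {m n} (f : Hom m n),
    toDaggerPropData.cast (Nat.add_zero m) (Nat.add_zero n) (tensor f (id 0)) = f
  braid_natural : ∀ {m n p q} (f : Hom m n) (g : Hom p q),
    comp (tensor f g) (braid n q) = comp (braid m p) (tensor g f)
  braid_braid : ∀ m n, comp (braid m n) (braid n m) = id (m + n)
  hexagon : ∀ m n p,
    toDaggerPropData.cast (Nat.add_assoc m n p) (Nat.add_assoc n p m).symm
      (comp (tensor (braid m n) (id p))
        (toDaggerPropData.cast (Nat.add_assoc n m p).symm rfl (tensor (id n) (braid m p))))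
      = braid m (n + p)
  hexagon' : ∀ m n p,
    toDaggerPropData.cast (Nat.add_assoc m n p).symm (Nat.add_assoc p m n)
      (comp (tensor (id m) (braid n p))
        (toDaggerPropData.cast (Nat.add_assoc m p n) rfl (tensor (braid m p) (id n))))
      = braid (m + n) p
  dagger_id : ∀ n, dagger (id n) = id n
  dagger_comp : ∀ {m n p} (f : Hom m n) (g : Hom n p),
    dagger (comp f g) = comp (dagger g) (dagger f)
  dagger_dagger : ∀ {m n} (f : Hom m n), dagger (dagger f) = f
  dagger_tensor : ∀ {m n p q} (f : Hom m n) (g : Hom p q),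
    dagger (tensor f g) = tensor (dagger f) (dagger g)
  /-- The braiding is unitary: its dagger is its inverse, see `braid_braid`. -/
  dagger_braid : ∀ m n, dagger (braid m n) = braid n m

/-- A morphism of dagger props: a strict symmetric monoidal functor that is the identity on
objects and commutes with the daggers. -/
structure DaggerPropHom (P : DaggerProp.{u}) (Q : DaggerProp.{v}) where
  map : ∀ {m n}, P.toDaggerPropData.Hom m n → Q.toDaggerPropData.Hom m n
  map_id : ∀ n, map (P.id n) = Q.id n
  map_comp : ∀ {m n p} (f : P.toDaggerPropData.Hom m n) (g : P.toDaggerPropData.Hom n p),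
    map (P.comp f g) = Q.comp (map f) (map g)
  map_tensor : ∀ {m n p q} (f : P.toDaggerPropData.Hom m n) (g : P.toDaggerPropData.Hom p q),
    map (P.tensor f g) = Q.tensor (map f) (map g)
  map_braid : ∀ m n, map (P.braid m n) = Q.braid m n
  map_dagger : ∀ {m n} (f : P.toDaggerPropData.Hom m n), map (P.dagger f) = Q.dagger (map f)

/-! Transport along equalities of objects. -/

section Cast

variable (P : DaggerPropData.{u})

theorem cast_rfl {m n : ℕ} (f : P.Hom m n) : P.cast rfl rfl f = f := rfl

theorem cast_cast {m n m' n' m'' n'' : ℕ} (h : m = m') (h' : n = n') (k : m' = m'') (k' : n' = n'')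
    (f : P.Hom m n) : P.cast k k' (P.cast h h' f) = P.cast (h.trans k) (h'.trans k') f := by
  subst h h' k k'; rfl

theorem comp_cast_cast {m n p m' n' p' : ℕ} (h : m = m') (h' : n = n') (h'' : p = p')
    (f : P.Hom m n) (g : P.Hom n p) :
    P.comp (P.cast h h' f) (P.cast h' h'' g) = P.cast h h'' (P.comp f g) := by
  subst h h' h''; rfl

theorem tensor_cast_cast {m n p q m' n' p' q' : ℕ} (h : m = m') (h' : n = n') (k : p = p')
    (k' : q = q') (f : P.Hom m n) (g : P.Hom p q) :
    P.tensor (P.cast h h' f) (P.cast k k' g)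
      = P.cast (congrArg₂ (· + ·) h k) (congrArg₂ (· + ·) h' k') (P.tensor f g) := by
  subst h h' k k'; rfl

theorem dagger_cast {m n m' n' : ℕ} (h : m = m') (h' : n = n') (f : P.Hom m n) :
    P.dagger (P.cast h h' f) = P.cast h' h (P.dagger f) := by
  subst h h'; rfl

end Cast

/-- Operations that embed faithfully, and compatibly with all operations, in a dagger prop
satisfy the laws of a dagger prop. -/
def DaggerPropData.ofEmbedding (D : DaggerPropData.{u}) (P : DaggerProp.{v})
    (φ : ∀ {m n}, D.Hom m n → P.toDaggerPropData.Hom m n)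
    (inj : ∀ {m n} {f g : D.Hom m n}, φ f = φ g → f = g)
    (φ_id : ∀ n, φ (D.id n) = P.id n)
    (φ_comp : ∀ {m n p} (f : D.Hom m n) (g : D.Hom n p),
      φ (D.comp f g) = P.comp (φ f) (φ g))
    (φ_tensor : ∀ {m n p q} (f : D.Hom m n) (g : D.Hom p q),
      φ (D.tensor f g) = P.tensor (φ f) (φ g))
    (φ_braid : ∀ m n, φ (D.braid m n) = P.braid m n)
    (φ_dagger : ∀ {m n} (f : D.Hom m n), φ (D.dagger f) = P.dagger (φ f)) :
    DaggerProp.{u} :=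
  have φ_cast : ∀ {m n m' n' : ℕ} (h : m = m') (h' : n = n') (f : D.Hom m n),
      φ (D.cast h h' f) = P.cast h h' (φ f) := by
    intro m n m' n' h h' f; subst h h'; rfl
  { D with
    id_comp := fun f => inj (by rw [φ_comp, φ_id, P.id_comp])
    comp_id := fun f => inj (by rw [φ_comp, φ_id, P.comp_id])
    comp_assoc := fun f g h => inj (by simp only [φ_comp, P.comp_assoc])
    id_tensor_id := fun m n => inj (by simp only [φ_tensor, φ_id, P.id_tensor_id])
    interchange := fun f g f' g' => inj (by simp only [φ_tensor, φ_comp, P.interchange])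
    tensor_assoc := fun f g h => inj (by simp only [φ_cast, φ_tensor, P.tensor_assoc])
    id_tensor := fun f => inj (by simp only [φ_cast, φ_tensor, φ_id, P.id_tensor])
    tensor_id_zero := fun f => inj (by simp only [φ_cast, φ_tensor, φ_id, P.tensor_id_zero])
    braid_natural := fun f g => inj (by
      simp only [φ_comp, φ_tensor, φ_braid, P.braid_natural])
    braid_braid := fun m n => inj (by simp only [φ_comp, φ_braid, φ_id, P.braid_braid])
    hexagon := fun m n p => inj (by
      simp only [φ_cast, φ_comp, φ_tensor, φ_braid, φ_id, P.hexagon])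
    hexagon' := fun m n p => inj (by
      simp only [φ_cast, φ_comp, φ_tensor, φ_braid, φ_id, P.hexagon'])
    dagger_id := fun n => inj (by simp only [φ_dagger, φ_id, P.dagger_id])
    dagger_comp := fun f g => inj (by simp only [φ_dagger, φ_comp, P.dagger_comp])
    dagger_dagger := fun f => inj (by simp only [φ_dagger, P.dagger_dagger])
    dagger_tensor := fun f g => inj (by simp only [φ_dagger, φ_tensor, P.dagger_tensor])
    dagger_braid := fun m n => inj (by simp only [φ_dagger, φ_braid, P.dagger_braid]) }

/-! ### The dagger prop of multiples of an object -/

/-- The full symmetric monoidal dagger subcategory of `P` on the objects `0, c, 2c, 3c, …`,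
regarded as a prop by naming the object `c * n` by `n`. -/
def DaggerProp.multiplesData (P : DaggerProp.{u}) (c : ℕ) : DaggerPropData.{u} where
  Hom m n := P.toDaggerPropData.Hom (c * m) (c * n)
  id n := P.id (c * n)
  comp f g := P.comp f g
  tensor {m n p q} f g := P.cast (Nat.mul_add c m p).symm (Nat.mul_add c n q).symm (P.tensor f g)
  braid m n := P.cast (Nat.mul_add c m n).symm (Nat.mul_add c n m).symm
    (P.braid (c * m) (c * n))
  dagger f := P.dagger f

theorem DaggerProp.multiplesData_cast (P : DaggerProp.{u}) (c : ℕ) {m n m' n' : ℕ} (h : m = m')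
    (h' : n = n') (f : (P.multiplesData c).Hom m n) :
    (P.multiplesData c).cast h h' f
      = P.cast (congrArg (c * ·) h) (congrArg (c * ·) h') f := by
  subst h h'; rfl

theorem hexagon_cast (P : DaggerProp.{u}) {a b d x x' y z z' t t' s s' w w' : ℕ}
    (h1 : a + b = x) (h2 : b + a = x') (h3 : a + d = z) (h4 : d + a = z') (h5 : b + d = y)
    (h6 : x + d = t) (h7 : x' + d = t') (h8 : b + z = s) (h9 : b + z' = s')
    (h10 : a + y = w) (h11 : y + a = w') (h12 : s = t') (h13 : t = w) (h14 : s' = w') :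
    P.cast h13 h14 (P.comp (P.cast h6 h7 (P.tensor (P.cast h1 h2 (P.braid a b)) (P.id d)))
      (P.cast h12 rfl (P.cast h8 h9 (P.tensor (P.id b) (P.cast h3 h4 (P.braid a d))))))
    = P.cast h10 h11 (P.braid a y) := by
  subst h1 h2 h3 h4 h5 h6 h7 h8 h9 h10 h11
  exact P.hexagon a b d

theorem hexagon_cast' (P : DaggerProp.{u}) {a b d x x' y z z' t t' s s' w w' : ℕ}
    (h1 : b + d = x) (h2 : d + b = x') (h3 : a + d = z) (h4 : d + a = z') (h5 : a + b = y)
    (h6 : a + x = t) (h7 : a + x' = t') (h8 : z + b = s) (h9 : z' + b = s')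
    (h10 : y + d = w) (h11 : d + y = w') (h12 : s = t') (h13 : t = w) (h14 : s' = w') :
    P.cast h13 h14 (P.comp (P.cast h6 h7 (P.tensor (P.id a) (P.cast h1 h2 (P.braid b d))))
      (P.cast h12 rfl (P.cast h8 h9 (P.tensor (P.cast h3 h4 (P.braid a d)) (P.id b)))))
    = P.cast h10 h11 (P.braid y d) := by
  subst h1 h2 h3 h4 h5 h6 h7 h8 h9 h10 h11
  exact P.hexagon' a b d

/-- The dagger prop with the operations `DaggerProp.multiplesData`. -/
def DaggerProp.multiples (P : DaggerProp.{u}) (c : ℕ) : DaggerProp.{u} where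
  toDaggerPropData := P.multiplesData c
  id_comp f := P.id_comp _
  comp_id f := P.comp_id _
  comp_assoc f g h := P.comp_assoc _ _ _
  id_tensor_id m n := by
    simp only [multiplesData, P.id_tensor_id]
    generalize_proofs h
    revert h
    generalize c * (m + n) = a
    rintro rfl
    rfl
  interchange {m n p m' n' p'} f g f' g' :=
    (congrArg (P.cast _ _) (P.interchange (m := c * m) (n := c * n) (p := c * p) (m' := c * m')
      (n' := c * n') (p' := c * p') f g f' g')).trans (comp_cast_cast _ _ _ _ _ _).symm
  tensor_assoc {m n p q r s} f g h := by
    rw [multiplesData_cast]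
    simp only [multiplesData]
    have e1 := tensor_cast_cast P.toDaggerPropData (m := c * m + c * p) (n := c * n + c * q)
      (p := c * r) (q := c * s) (Nat.mul_add c _ _).symm (Nat.mul_add c _ _).symm
      rfl rfl (P.tensor f g) h
    have e2 := tensor_cast_cast P.toDaggerPropData (m := c * m) (n := c * n)
      (p := c * p + c * r) (q := c * q + c * s) rfl rfl (Nat.mul_add c _ _).symm
      (Nat.mul_add c _ _).symm f (P.tensor g h)
    refine (congrArg _ (congrArg _ e1)).trans (Eq.trans ?_ (congrArg _ e2).symm)
    refine Eq.trans ?_ (congrArg _ (congrArg _ (P.tensor_assoc (m := c * m) (n := c * n)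
      (p := c * p) (q := c * q) (r := c * r) (s := c * s) f g h)))
    simp only [cast_cast]
  id_tensor {m n} f := by
    rw [multiplesData_cast]
    simp only [multiplesData]
    rw [cast_cast]
    exact P.id_tensor (m := c * m) (n := c * n) f
  tensor_id_zero {m n} f := by
    rw [multiplesData_cast]
    simp only [multiplesData]
    rw [cast_cast]
    exact P.tensor_id_zero (m := c * m) (n := c * n) f
  braid_natural {m n p q} f g :=
    (comp_cast_cast _ _ _ _ _ _).trans ((congrArg (P.cast _ _) (P.braid_natural (m := c * m)
      (n := c * n) (p := c * p) (q := c * q) f g)).trans (comp_cast_cast _ _ _ _ _ _).symm)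
  braid_braid m n := by
    simp only [multiplesData, comp_cast_cast, P.braid_braid]
    generalize_proofs h
    revert h
    generalize c * (m + n) = a
    rintro rfl
    rfl
  hexagon m n p := by
    rw [multiplesData_cast, multiplesData_cast]
    exact hexagon_cast P _ _ _ _ (Nat.mul_add c _ _).symm _ _ _ _ _ _ _ _ _
  hexagon' m n p := by
    rw [multiplesData_cast, multiplesData_cast]
    exact hexagon_cast' P _ _ _ _ (Nat.mul_add c _ _).symm _ _ _ _ _ _ _ _ _
  dagger_id n := P.dagger_id _
  dagger_comp f g := P.dagger_comp _ _
  dagger_dagger f := P.dagger_dagger _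
  dagger_tensor {m n p q} f g := (dagger_cast _ _ _ _).trans (congrArg (P.cast _ _)
    (P.dagger_tensor (m := c * m) (n := c * n) (p := c * p) (q := c * q) f g))
  dagger_braid m n := by simp only [multiplesData, dagger_cast, P.dagger_braid]

/-! ### Sub-props generated by morphisms -/

/-- The morphisms of `P` that can be built from a family `S` of morphisms by composing and
tensoring with one another and with identities and braidings. -/
inductive DaggerProp.Generated (P : DaggerProp.{u})
    (S : ∀ m n, P.toDaggerPropData.Hom m n → Prop) :
    ∀ m n, P.toDaggerPropData.Hom m n → Prop
  | gen {m n} (f : P.toDaggerPropData.Hom m n) : S m n f → Generated P S m n f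
  | id (n) : Generated P S n n (P.id n)
  | braid (m n) : Generated P S (m + n) (n + m) (P.braid m n)
  | comp {m n p} (f : P.toDaggerPropData.Hom m n) (g : P.toDaggerPropData.Hom n p) :
      Generated P S m n f → Generated P S n p g → Generated P S m p (P.comp f g)
  | tensor {m n p q} (f : P.toDaggerPropData.Hom m n) (g : P.toDaggerPropData.Hom p q) :
      Generated P S m n f → Generated P S p q g →
      Generated P S (m + p) (n + q) (P.tensor f g)

theorem DaggerProp.Generated.dagger {P : DaggerProp.{u}}
    {S : ∀ m n, P.toDaggerPropData.Hom m n → Prop}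
    (hS : ∀ m n f, S m n f → S n m (P.dagger f)) {m n : ℕ} {f : P.toDaggerPropData.Hom m n}
    (hf : P.Generated S m n f) : P.Generated S n m (P.dagger f) := by
  induction hf with
  | gen f h => exact .gen _ (hS _ _ _ h)
  | id n => rw [P.dagger_id]; exact .id n
  | braid m n => rw [P.dagger_braid]; exact .braid n m
  | comp f g _ _ hf hg => rw [P.dagger_comp]; exact .comp _ _ hg hf
  | tensor f g _ _ hf hg => rw [P.dagger_tensor]; exact .tensor _ _ hf hg

/-- The sub-prop of `P` generated by a family of morphisms that is closed under the dagger, with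
the operations of `P`. -/
def DaggerProp.sub (P : DaggerProp.{u}) (S : ∀ m n, P.toDaggerPropData.Hom m n → Prop)
    (hS : ∀ m n f, S m n f → S n m (P.dagger f)) : DaggerProp.{u} :=
  DaggerPropData.ofEmbedding
    { Hom := fun m n => {f : P.toDaggerPropData.Hom m n // P.Generated S m n f}
      id := fun n => ⟨P.id n, .id n⟩
      comp := fun f g => ⟨P.comp f.1 g.1, .comp _ _ f.2 g.2⟩
      tensor := fun f g => ⟨P.tensor f.1 g.1, .tensor _ _ f.2 g.2⟩
      braid := fun m n => ⟨P.braid m n, .braid m n⟩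
      dagger := fun f => ⟨P.dagger f.1, f.2.dagger hS⟩ }
    P (fun f => f.1) Subtype.ext (fun _ => rfl) (fun _ _ => rfl) (fun _ _ => rfl)
    (fun _ _ => rfl) (fun _ => rfl)

/-! ### The dagger prop of relations between powers of a set -/

section Relations

variable (A : Type v)

/-- Relations from `A ^ m` to `A ^ n`, with relational composition and with the cartesian product
of relations as tensor product. -/
def relData : DaggerPropData.{v} where
  Hom m n := (Fin m → A) → (Fin n → A) → Prop
  id _ x y := x = y
  comp R S x z := ∃ y, R x y ∧ S y z
  tensor {m n p q} R S x y :=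
    R (fun i => x (Fin.castAdd p i)) (fun i => y (Fin.castAdd q i)) ∧
      S (fun i => x (Fin.natAdd m i)) (fun i => y (Fin.natAdd n i))
  braid m n x y := (∀ i, x (Fin.castAdd n i) = y (Fin.natAdd n i)) ∧
    ∀ i, x (Fin.natAdd m i) = y (Fin.castAdd m i)
  dagger R y x := R x y

variable {A}

theorem relData_cast {m n m' n' : ℕ} (h : m = m') (h' : n = n') (R : (relData A).Hom m n) :
    (relData A).cast h h' R = fun x y => R (x ∘ Fin.cast h) (y ∘ Fin.cast h') := by
  subst h h'; rfl

theorem split_ext {m n : ℕ} {x y : Fin (m + n) → A}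
    (h : ∀ i, x (Fin.castAdd n i) = y (Fin.castAdd n i))
    (h' : ∀ i, x (Fin.natAdd m i) = y (Fin.natAdd m i)) : x = y :=
  funext fun i => Fin.addCases h h' i

@[simp] theorem cast_natAdd_assoc {m n p : ℕ} (h : m + n + p = m + (n + p)) (i : Fin p) :
    Fin.cast h (Fin.natAdd (m + n) i) = Fin.natAdd m (Fin.natAdd n i) :=
  Fin.ext (by simp [Nat.add_assoc])

@[simp] theorem cast_natAdd_assoc_symm {m n p : ℕ} (h : m + (n + p) = m + n + p) (i : Fin p) :
    Fin.cast h (Fin.natAdd m (Fin.natAdd n i)) = Fin.natAdd (m + n) i :=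
  Fin.ext (by simp [Nat.add_assoc])

@[simp] theorem cast_castAdd_castAdd {m n p : ℕ} (h : m + n + p = m + (n + p)) (i : Fin m) :
    Fin.cast h (Fin.castAdd p (Fin.castAdd n i)) = Fin.castAdd (n + p) i := rfl

@[simp] theorem cast_castAdd_natAdd {m n p : ℕ} (h : m + n + p = m + (n + p)) (i : Fin n) :
    Fin.cast h (Fin.castAdd p (Fin.natAdd m i)) = Fin.natAdd m (Fin.castAdd p i) := rfl

@[simp] theorem cast_castAdd_symm {m n p : ℕ} (h : m + (n + p) = m + n + p) (i : Fin m) :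
    Fin.cast h (Fin.castAdd (n + p) i) = Fin.castAdd p (Fin.castAdd n i) := rfl

@[simp] theorem cast_natAdd_castAdd_symm {m n p : ℕ} (h : m + (n + p) = m + n + p) (i : Fin n) :
    Fin.cast h (Fin.natAdd m (Fin.castAdd p i)) = Fin.castAdd p (Fin.natAdd m i) := rfl

variable (A)

/-- The dagger prop with the operations `relData`. -/
def relProp : DaggerProp.{v} where
  toDaggerPropData := relData A
  id_comp f := by funext x y; simp [relData]
  comp_id f := by funext x y; simp [relData]
  comp_assoc f g h := by
    funext x y
    simp only [relData, eq_iff_iff]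
    constructor
    · rintro ⟨z, ⟨w, h1, h2⟩, h3⟩; exact ⟨w, h1, z, h2, h3⟩
    · rintro ⟨w, h1, z, h2, h3⟩; exact ⟨z, ⟨w, h1, h2⟩, h3⟩
  id_tensor_id m n := by
    funext x y
    simp only [relData, eq_iff_iff]
    constructor
    · rintro ⟨h, h'⟩; exact split_ext (congrFun h) (congrFun h')
    · rintro rfl; exact ⟨rfl, rfl⟩
  interchange f g f' g' := by
    funext x y
    simp only [relData, eq_iff_iff]
    constructor
    · rintro ⟨⟨z, h1, h2⟩, ⟨w, h3, h4⟩⟩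
      exact ⟨Fin.append z w, by simpa using ⟨⟨h1, h3⟩, h2, h4⟩⟩
    · rintro ⟨z, ⟨h1, h2⟩, h3, h4⟩
      exact ⟨⟨_, h1, h3⟩, _, h2, h4⟩
  tensor_assoc {m n p q r s} f g h := by
    rw [relData_cast]
    funext x y
    simp only [relData, eq_iff_iff, and_assoc]
    refine and_congr Iff.rfl (and_congr ?_ ?_)
    · rw [show (fun i => (x ∘ Fin.cast (Nat.add_assoc m p r)) (Fin.castAdd r (Fin.natAdd m i)))
          = fun i => x (Fin.natAdd m (Fin.castAdd r i)) from rfl]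
      exact Iff.rfl
    · have e1 : (fun i => (x ∘ Fin.cast (Nat.add_assoc m p r)) (Fin.natAdd (m + p) i))
          = fun i => x (Fin.natAdd m (Fin.natAdd p i)) := by
        funext i; simp
      have e2 : (fun i => (y ∘ Fin.cast (Nat.add_assoc n q s)) (Fin.natAdd (n + q) i))
          = fun i => y (Fin.natAdd n (Fin.natAdd q i)) := by
        funext i; simp
      rw [e1, e2]
  id_tensor {m n} f := by
    rw [relData_cast]
    funext x y
    simp only [relData, eq_iff_iff]
    have e1 : (fun i => (x ∘ Fin.cast (Nat.zero_add m)) (Fin.natAdd 0 i)) = x := by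
      funext i; exact congrArg x (Fin.ext (by simp))
    have e2 : (fun i => (y ∘ Fin.cast (Nat.zero_add n)) (Fin.natAdd 0 i)) = y := by
      funext i; exact congrArg y (Fin.ext (by simp))
    rw [e1, e2]
    exact and_iff_right (Subsingleton.elim _ _)
  tensor_id_zero f := by
    rw [relData_cast]
    funext x y
    simp only [relData, eq_iff_iff]
    exact and_iff_left (Subsingleton.elim _ _)
  braid_natural {m n p q} f g := by
    funext x y
    simp only [relData, eq_iff_iff]
    constructor
    · rintro ⟨z, ⟨h1, h2⟩, h3, h4⟩
      refine ⟨Fin.append (fun i => x (Fin.natAdd m i)) (fun i => x (Fin.castAdd p i)), ?_, ?_⟩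
      · simp
      · simp only [Fin.append_left, Fin.append_right, ← h3, ← h4]
        exact ⟨h2, h1⟩
    · rintro ⟨z, ⟨h1, h2⟩, h3, h4⟩
      refine ⟨Fin.append (fun i => y (Fin.natAdd q i)) (fun i => y (Fin.castAdd n i)), ?_, ?_⟩
      · simp only [Fin.append_left, Fin.append_right, h1, h2]
        exact ⟨h4, h3⟩
      · simp
  braid_braid m n := by
    funext x y
    simp only [relData, eq_iff_iff]
    constructor
    · rintro ⟨z, ⟨h1, h2⟩, h3, h4⟩
      exact split_ext (fun i => (h1 i).trans (h4 i)) (fun i => (h2 i).trans (h3 i))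
    · rintro rfl
      exact ⟨Fin.append (fun i => x (Fin.natAdd m i)) (fun i => x (Fin.castAdd n i)), by simp⟩
  hexagon m n p := by
    rw [relData_cast, relData_cast]
    funext x y
    simp only [relData, eq_iff_iff, funext_iff, Function.comp_apply, Fin.cast_eq_self,
      cast_natAdd_assoc, cast_natAdd_assoc_symm, cast_castAdd_castAdd,
      cast_castAdd_natAdd, cast_castAdd_symm, cast_natAdd_castAdd_symm]
    constructor
    · rintro ⟨z, ⟨⟨h1, h2⟩, h3⟩, h4, h5, h6⟩
      refine ⟨fun i => ?_, fun i => Fin.addCases (fun j => ?_) (fun j => ?_) i⟩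
      · simpa using (h1 i).trans (h5 i)
      · simpa using (h2 j).trans (h4 j)
      · simpa using (h3 j).trans (h6 j)
    · rintro ⟨h1, h2⟩
      refine ⟨Fin.append (Fin.append (fun i => x (Fin.natAdd m (Fin.castAdd p i)))
        (fun i => x (Fin.castAdd (n + p) i))) (fun i => x (Fin.natAdd m (Fin.natAdd n i))), ?_⟩
      have h3 := fun i => h2 (Fin.castAdd p i)
      have h4 := fun i => h2 (Fin.natAdd n i)
      simp only [Fin.append_left, Fin.append_right] at h1 h3 h4 ⊢
      exact ⟨⟨⟨fun _ => trivial, fun _ => trivial⟩, fun _ => trivial⟩, h3, h1, h4⟩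
  hexagon' m n p := by
    rw [relData_cast, relData_cast]
    funext x y
    simp only [relData, eq_iff_iff, funext_iff, Function.comp_apply, Fin.cast_eq_self,
      cast_natAdd_assoc, cast_natAdd_assoc_symm, cast_castAdd_castAdd,
      cast_castAdd_natAdd, cast_castAdd_symm, cast_natAdd_castAdd_symm]
    constructor
    · rintro ⟨z, ⟨h1, h2, h3⟩, ⟨h4, h5⟩, h6⟩
      refine ⟨fun i => ?_, fun i => ?_⟩
      · induction i using Fin.addCases with
        | left j => simpa using (h1 j).trans (h4 j)
        | right j => simpa using (h2 j).trans (h6 j)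
      · simpa using (h3 i).trans (h5 i)
    · rintro ⟨h1, h2⟩
      refine ⟨Fin.append (fun i => x (Fin.castAdd p (Fin.castAdd n i)))
        (Fin.append (fun i => x (Fin.natAdd (m + n) i))
          (fun i => x (Fin.castAdd p (Fin.natAdd m i)))), ?_⟩
      have h3 := fun i => h1 (Fin.castAdd n i)
      have h4 := fun i => h1 (Fin.natAdd m i)
      simp only [Fin.append_left, Fin.append_right] at h2 h3 h4 ⊢
      exact ⟨⟨fun _ => trivial, fun _ => trivial, fun _ => trivial⟩, ⟨h3, h2⟩, h4⟩
  dagger_id n := by funext x y; exact propext eq_comm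
  dagger_comp f g := by funext x y; simp only [relData, and_comm]
  dagger_dagger f := rfl
  dagger_tensor f g := rfl
  dagger_braid m n := by
    funext x y
    simp only [relData, eq_iff_iff]
    constructor
    · rintro ⟨h, h'⟩; exact ⟨fun i => (h' i).symm, fun i => (h i).symm⟩
    · rintro ⟨h, h'⟩; exact ⟨fun i => (h' i).symm, fun i => (h i).symm⟩

end Relations

/-! ### Corelations -/

/-- The operations of the dagger prop of corelations: a morphism from `m` to `n` is a partition of
the disjoint union of an `m`-element set and an `n`-element set. -/
def finCorelData : DaggerPropData.{0} where
  Hom m n := Setoid (Fin m ⊕ Fin n)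
  /- The parts of the identity are the pairs consisting of an input and the same output. -/
  id n := Setoid.ker (Sum.elim _root_.id _root_.id : Fin n ⊕ Fin n → Fin n)
  /- Glue the two partitions along the middle set, to the finest common coarsening on the union of
  all three sets, and restrict to the outer sets. -/
  comp {m n p} R S :=
    Setoid.comap (Sum.map _root_.id Sum.inr : Fin m ⊕ Fin p → Fin m ⊕ (Fin n ⊕ Fin p))
      (Setoid.map R (Sum.map _root_.id Sum.inl) ⊔ Setoid.map S Sum.inr)
  /- Disjoint union of partitions. -/
  tensor {m n p q} R S :=
    Setoid.map R (Sum.map (Fin.castAdd p) (Fin.castAdd q)) ⊔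
      Setoid.map S (Sum.map (Fin.natAdd m) (Fin.natAdd n))
  /- The parts are the pairs consisting of an input and its image under the block swap. -/
  braid m n :=
    Setoid.ker (Sum.elim finAddFlip _root_.id : Fin (m + n) ⊕ Fin (n + m) → Fin (n + m))
  dagger R := Setoid.comap Sum.swap R

section Invariants

variable {α β : Type}

theorem setoid_map_le_ker {γ : Type*} {r : Setoid α} {f : α → β} {g : β → γ} :
    Setoid.map r f ≤ Setoid.ker g ↔ r ≤ Setoid.ker (g ∘ f) := by
  constructor
  · intro h a b hab
    exact h (Setoid.le_comap_map hab)
  · intro h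
    refine Setoid.eqvGen_le ?_
    rintro _ _ ⟨a, b, hab, rfl, rfl⟩
    exact h hab

end Invariants

/-- The predicates that are constant on the parts of a corelation, as a relation. -/
def finCorelInv {m n : ℕ} (R : Setoid (Fin m ⊕ Fin n)) : (relData Prop).Hom m n :=
  fun x y => R ≤ Setoid.ker (Sum.elim x y)

theorem finCorelInv_injective {m n : ℕ} {R S : Setoid (Fin m ⊕ Fin n)}
    (h : finCorelInv R = finCorelInv S) : R = S := by
  have key : ∀ {R S : Setoid (Fin m ⊕ Fin n)}, finCorelInv R = finCorelInv S → R ≤ S := by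
    intro R S h a b hab
    have h1 : finCorelInv S (fun i => S a (Sum.inl i)) (fun j => S a (Sum.inr j)) := by
      intro c d hcd
      have e : (Sum.elim (fun i => S a (Sum.inl i)) (fun j => S a (Sum.inr j))
        : Fin m ⊕ Fin n → Prop) = fun c => S a c := by
        funext c; cases c <;> rfl
      rw [Setoid.ker_def, e]
      exact propext ⟨fun h => S.trans' h hcd, fun h => S.trans' h (S.symm' hcd)⟩
    rw [← h] at h1
    have e : (Sum.elim (fun i => S a (Sum.inl i)) (fun j => S a (Sum.inr j))
        : Fin m ⊕ Fin n → Prop) = fun c => S a c := by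
      funext c; cases c <;> rfl
    have h2 := h1 hab
    rw [Setoid.ker_def, e] at h2
    exact (iff_of_eq h2).1 (S.refl' a)
  exact le_antisymm (key h) (key h.symm)

theorem finCorelInv_comp {m n p : ℕ} (R : Setoid (Fin m ⊕ Fin n)) (S : Setoid (Fin n ⊕ Fin p)) :
    finCorelInv (finCorelData.comp R S)
      = (relData Prop).comp (finCorelInv R) (finCorelInv S) := by
  funext x z
  refine propext ⟨fun h => ?_, ?_⟩
  · let T : Setoid (Fin m ⊕ (Fin n ⊕ Fin p)) :=
      Setoid.map R (Sum.map _root_.id Sum.inl) ⊔ Setoid.map S Sum.inr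
    let j : Fin m ⊕ Fin p → Fin m ⊕ (Fin n ⊕ Fin p) := Sum.map _root_.id Sum.inr
    let w : Fin m ⊕ (Fin n ⊕ Fin p) → Prop := fun a => ∃ c, T a (j c) ∧ Sum.elim x z c
    have hw : T ≤ Setoid.ker w := by
      intro a b hab
      exact propext ⟨fun ⟨c, h1, h2⟩ => ⟨c, T.trans' (T.symm' hab) h1, h2⟩,
        fun ⟨c, h1, h2⟩ => ⟨c, T.trans' hab h1, h2⟩⟩
    have hj : ∀ c, w (j c) = Sum.elim x z c := by
      intro c
      refine propext ⟨?_, fun h => ⟨c, T.refl' _, h⟩⟩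
      rintro ⟨d, h1, h2⟩
      have h3 : Sum.elim x z c = Sum.elim x z d := h h1
      rwa [h3]
    have hT := sup_le_iff.1 hw
    refine ⟨fun i => w (Sum.inr (Sum.inl i)), ?_, ?_⟩
    · have := setoid_map_le_ker.1 hT.1
      refine this.trans_eq (congrArg Setoid.ker ?_)
      funext a
      rcases a with a | a
      · exact hj (Sum.inl a)
      · rfl
    · have := setoid_map_le_ker.1 hT.2
      refine this.trans_eq (congrArg Setoid.ker ?_)
      funext a
      rcases a with a | a
      · rfl
      · exact hj (Sum.inr a)
  · rintro ⟨y, h1, h2⟩ a b hab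
    have hT : Setoid.map R (Sum.map _root_.id Sum.inl) ⊔ Setoid.map S Sum.inr
        ≤ Setoid.ker (Sum.elim x (Sum.elim y z)) := by
      refine sup_le (setoid_map_le_ker.2 ?_) (setoid_map_le_ker.2 ?_)
      · refine (show R ≤ _ from h1).trans_eq (congrArg Setoid.ker ?_)
        funext a; cases a <;> rfl
      · exact h2
    have := hT hab
    rw [Setoid.ker_def] at this ⊢
    rcases a with a | a <;> rcases b with b | b <;> exact this

theorem finCorelInv_ker {m n k : ℕ} (f : Fin m → Fin k) (x : Fin m → Prop) (y : Fin n → Prop)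
    (e : Fin k ≃ Fin n) :
    finCorelInv (Setoid.ker (Sum.elim f e.symm)) x y ↔ ∀ i, x i = y (e (f i)) := by
  constructor
  · intro h i
    exact h (x := Sum.inl i) (y := Sum.inr (e (f i))) (by simp [Setoid.ker_def])
  · intro h a b hab
    rw [Setoid.ker_def] at hab ⊢
    have key : ∀ c, Sum.elim x y c = y (e (Sum.elim f e.symm c)) := by
      rintro (c | c)
      · exact h c
      · simp
    rw [key, key, hab]

/-- The dagger prop of corelations. -/
def FinCorel : DaggerProp.{0} :=
  finCorelData.ofEmbedding (relProp Prop) finCorelInv finCorelInv_injective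
    (by
      intro n
      funext x y
      exact propext ((finCorelInv_ker _root_.id x y (Equiv.refl _)).trans funext_iff.symm))
    finCorelInv_comp
    (by
      intro m n p q R S
      funext x y
      refine propext (sup_le_iff.trans (and_congr ?_ ?_))
      · refine setoid_map_le_ker.trans ?_
        rw [Sum.elim_comp_map]; exact Iff.rfl
      · refine setoid_map_le_ker.trans ?_
        rw [Sum.elim_comp_map]; exact Iff.rfl)
    (by
      intro m n
      funext x y
      refine propext ((finCorelInv_ker finAddFlip x y (Equiv.refl _)).trans ?_)
      constructor
      · intro h
        exact ⟨fun i => by simpa using h (Fin.castAdd n i),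
          fun i => by simpa using h (Fin.natAdd m i)⟩
      · rintro ⟨h1, h2⟩ i
        induction i using Fin.addCases with
        | left i => simpa using h1 i
        | right i => simpa using h2 i)
    (by
      intro m n (R : Setoid (Fin m ⊕ Fin n))
      funext y x
      refine propext ⟨fun h a b hab => ?_, fun h a b hab => ?_⟩
      · have := h (x := a.swap) (y := b.swap)
          (by change R a.swap.swap b.swap.swap; simpa using hab)
        rw [Setoid.ker_def] at this ⊢
        rcases a with a | a <;> rcases b with b | b <;> exact this
      · have := h (x := a.swap) (y := b.swap) hab
        rw [Setoid.ker_def] at this ⊢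
        rcases a with a | a <;> rcases b with b | b <;> exact this)

/-! ### Lagrangian relations -/

section Lagrangian

variable {k : Type u} [Field k]

/-- A subspace on which a bilinear form vanishes. -/
def IsIsotropic {V : Type*} [AddCommGroup V] [Module k V] (ω : LinearMap.BilinForm k V)
    (L : Submodule k V) : Prop :=
  ∀ v ∈ L, ∀ w ∈ L, ω v w = 0

/-- An isotropic subspace that is not properly contained in any other isotropic subspace. -/
def IsLagrangian {V : Type*} [AddCommGroup V] [Module k V] (ω : LinearMap.BilinForm k V)
    (L : Submodule k V) : Prop :=
  IsIsotropic ω L ∧ ∀ L' : Submodule k V, IsIsotropic ω L' → L ≤ L' → L' = L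

variable (k)

/-- The symplectic structure on `(k ⊕ k) ^ n`: the direct sum of `n` copies of the form
`ω (φ, I) (φ', I') = φ * I' - φ' * I` on `k ⊕ k`. -/
def symplecticForm (n : ℕ) : LinearMap.BilinForm k (Fin n → k × k) :=
  LinearMap.mk₂ k (fun x y => ∑ i, ((x i).1 * (y i).2 - (y i).1 * (x i).2))
    (fun x x' y => by
      rw [← Finset.sum_add_distrib]; exact Finset.sum_congr rfl fun i _ => by simp; ring)
    (fun c x y => by
      rw [smul_eq_mul, Finset.mul_sum]; exact Finset.sum_congr rfl fun i _ => by simp; ring)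
    (fun x y y' => by
      rw [← Finset.sum_add_distrib]; exact Finset.sum_congr rfl fun i _ => by simp; ring)
    (fun c x y => by
      rw [smul_eq_mul, Finset.mul_sum]; exact Finset.sum_congr rfl fun i _ => by simp; ring)

/-- The symplectic structure on the direct sum of the conjugate of `(k ⊕ k) ^ m` and
`(k ⊕ k) ^ n`. -/
def relationForm (m n : ℕ) : LinearMap.BilinForm k ((Fin m → k × k) × (Fin n → k × k)) :=
  LinearMap.mk₂ k (fun x y => -symplecticForm k m x.1 y.1 + symplecticForm k n x.2 y.2)
    (fun x x' y => by simp; ring) (fun c x y => by simp; ring)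
    (fun x y y' => by simp; ring) (fun c x y => by simp; ring)

/-- Linear Lagrangian relations from `(k ⊕ k) ^ m` to `(k ⊕ k) ^ n`. -/
def LagHom (m n : ℕ) : Type u :=
  {L : Submodule k ((Fin m → k × k) × (Fin n → k × k)) // IsLagrangian (relationForm k m n) L}

variable {k}

theorem isLagrangian_iff {V : Type*} [AddCommGroup V] [Module k V]
    {ω : LinearMap.BilinForm k V} (hω : ω.IsAlt) {L : Submodule k V} :
    IsLagrangian ω L ↔ ∀ v, v ∈ L ↔ ∀ w ∈ L, ω w v = 0 := by
  constructor
  · rintro ⟨h1, h2⟩ v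
    refine ⟨fun hv w hw => h1 w hw v hv, fun h => ?_⟩
    have h3 : L ⊔ k ∙ v = L := by
      refine h2 _ ?_ le_sup_left
      intro a ha b hb
      obtain ⟨a1, ha1, a2, ha2, rfl⟩ := Submodule.mem_sup.1 ha
      obtain ⟨b1, hb1, b2, hb2, rfl⟩ := Submodule.mem_sup.1 hb
      obtain ⟨c, rfl⟩ := Submodule.mem_span_singleton.1 ha2
      obtain ⟨d, rfl⟩ := Submodule.mem_span_singleton.1 hb2
      have h4 : ω v b1 = 0 := by rw [← hω.neg_eq, h b1 hb1, neg_zero]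
      have h5 : ω v v = 0 := hω v
      simp [h1 a1 ha1 b1 hb1, h a1 ha1, h4, h5]
    rw [← h3]
    exact Submodule.mem_sup_right (Submodule.mem_span_singleton_self v)
  · intro h
    refine ⟨fun v hv w hw => (h w).1 hw v hv, fun L' h' hL => le_antisymm ?_ hL⟩
    intro v hv
    exact (h v).2 fun w hw => h' w (hL hw) v hv

theorem symplecticForm_apply {n : ℕ} (x y : Fin n → k × k) :
    symplecticForm k n x y = ∑ i, ((x i).1 * (y i).2 - (y i).1 * (x i).2) := rfl

theorem relationForm_apply {m n : ℕ} (x y : (Fin m → k × k) × (Fin n → k × k)) :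
    relationForm k m n x y = -symplecticForm k m x.1 y.1 + symplecticForm k n x.2 y.2 := rfl

theorem symplecticForm_isAlt (n : ℕ) : (symplecticForm k n).IsAlt := fun x => by
  simp [symplecticForm_apply]

theorem relationForm_isAlt (m n : ℕ) : (relationForm k m n).IsAlt := fun x => by
  rw [relationForm_apply, symplecticForm_isAlt m x.1, symplecticForm_isAlt n x.2]; simp

theorem symplecticForm_single_right {n : ℕ} (x : Fin n → k × k) (i : Fin n) (a : k × k) :
    symplecticForm k n x (Pi.single i a) = (x i).1 * a.2 - a.1 * (x i).2 := by
  rw [symplecticForm_apply, Finset.sum_eq_single i]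
  · simp
  · intro j _ hj; simp [Pi.single_eq_of_ne hj]
  · simp

theorem symplecticForm_separating {n : ℕ} {x : Fin n → k × k}
    (h : ∀ y, symplecticForm k n x y = 0) : x = 0 := by
  funext i
  have h1 := h (Pi.single i (0, 1))
  have h2 := h (Pi.single i (1, 0))
  rw [symplecticForm_single_right] at h1 h2
  exact Prod.ext (by simpa using h1) (by simpa using h2)

theorem mem_lag {m n : ℕ} {L : Submodule k ((Fin m → k × k) × (Fin n → k × k))}
    (hL : IsLagrangian (relationForm k m n) L) {x : Fin m → k × k} {y : Fin n → k × k} :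
    (x, y) ∈ L ↔ ∀ x' y', (x', y') ∈ L → symplecticForm k m x' x = symplecticForm k n y' y := by
  rw [(isLagrangian_iff (relationForm_isAlt m n)).1 hL]
  simp only [Prod.forall, relationForm_apply, neg_add_eq_zero]

theorem isLagrangian_of {m n : ℕ} {L : Submodule k ((Fin m → k × k) × (Fin n → k × k))}
    (h : ∀ x y x' y', (x, y) ∈ L → (x', y') ∈ L →
      symplecticForm k m x' x = symplecticForm k n y' y)
    (h' : ∀ x y, (∀ x' y', (x', y') ∈ L →
      symplecticForm k m x' x = symplecticForm k n y' y) → (x, y) ∈ L) :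
    IsLagrangian (relationForm k m n) L := by
  rw [isLagrangian_iff (relationForm_isAlt m n)]
  simp only [Prod.forall, relationForm_apply, neg_add_eq_zero]
  exact fun x y => ⟨fun hx x' y' hx' => h x y x' y' hx hx', h' x y⟩

/-- The composite of two linear relations. -/
def linComp {U V W : Type*} [AddCommGroup U] [Module k U] [AddCommGroup V] [Module k V]
    [AddCommGroup W] [Module k W] (L : Submodule k (U × V)) (L' : Submodule k (V × W)) :
    Submodule k (U × W) where
  carrier := {x | ∃ v, (x.1, v) ∈ L ∧ (v, x.2) ∈ L'}
  zero_mem' := ⟨0, L.zero_mem, L'.zero_mem⟩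
  add_mem' := by
    rintro a b ⟨v, h1, h2⟩ ⟨w, h3, h4⟩
    exact ⟨v + w, L.add_mem h1 h3, L'.add_mem h2 h4⟩
  smul_mem' := by
    rintro c a ⟨v, h1, h2⟩
    exact ⟨c • v, L.smul_mem c h1, L'.smul_mem c h2⟩

/-- The orthogonal direct sum of two bilinear forms. -/
def prodForm {V W : Type*} [AddCommGroup V] [Module k V] [AddCommGroup W] [Module k W]
    (ω : LinearMap.BilinForm k V) (ω' : LinearMap.BilinForm k W) :
    LinearMap.BilinForm k (V × W) :=
  LinearMap.mk₂ k (fun a b => ω a.1 b.1 + ω' a.2 b.2)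
    (fun x x' y => by simp; ring) (fun c x y => by simp; ring)
    (fun x y y' => by simp; ring) (fun c x y => by simp; ring)

theorem isLagrangian_linComp {m n p : ℕ} {L : Submodule k ((Fin m → k × k) × (Fin n → k × k))}
    {L' : Submodule k ((Fin n → k × k) × (Fin p → k × k))}
    (hL : IsLagrangian (relationForm k m n) L) (hL' : IsLagrangian (relationForm k n p) L') :
    IsLagrangian (relationForm k m p) (linComp L L') := by
  refine isLagrangian_of ?_ ?_
  · rintro x z x' z' ⟨y, h1, h2⟩ ⟨y', h3, h4⟩
    exact ((mem_lag hL).1 h1 _ _ h3).trans ((mem_lag hL').1 h2 _ _ h4)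
  · intro x z h
    let T := ((Fin m → k × k) × (Fin n → k × k)) × ((Fin n → k × k) × (Fin p → k × k))
    let B : LinearMap.BilinForm k T := prodForm (relationForm k m n) (relationForm k n p)
    have hB : ∀ a b : T, B a b = relationForm k m n a.1 b.1 + relationForm k n p a.2 b.2 :=
      fun _ _ => rfl
    have hBalt : B.IsAlt := fun a => by
      rw [hB, relationForm_isAlt m n a.1, relationForm_isAlt n p a.2, add_zero]
    have hBsep : ∀ a : T, (∀ b, B a b = 0) → a = 0 := by
      rintro ⟨⟨a1, a2⟩, a3, a4⟩ h
      have e1 : a1 = 0 := symplecticForm_separating fun y => by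
        simpa [hB, relationForm_apply] using h ((y, 0), (0, 0))
      have e2 : a2 = 0 := symplecticForm_separating fun y => by
        simpa [hB, relationForm_apply] using h ((0, y), (0, 0))
      have e3 : a3 = 0 := symplecticForm_separating fun y => by
        simpa [hB, relationForm_apply] using h ((0, 0), (y, 0))
      have e4 : a4 = 0 := symplecticForm_separating fun y => by
        simpa [hB, relationForm_apply] using h ((0, 0), (0, y))
      rw [e1, e2, e3, e4]; rfl
    have hBnd : B.Nondegenerate :=
      (LinearMap.IsRefl.nondegenerate_iff_separatingLeft hBalt.isRefl).2 hBsep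
    let D : Submodule k T := LinearMap.range
      ((LinearMap.inr k (Fin m → k × k) (Fin n → k × k)).prod
        (LinearMap.inl k (Fin n → k × k) (Fin p → k × k)))
    let K : Submodule k T := L.prod L'
    have h1 : (((x, 0), (0, z)) : T) ∈ B.orthogonal (B.orthogonal (K ⊔ D)) := by
      rw [LinearMap.BilinForm.mem_orthogonal_iff]
      rintro ⟨⟨a, b⟩, b', c⟩ habc
      rw [LinearMap.BilinForm.mem_orthogonal_iff] at habc
      have hK : ∀ t ∈ K, B t ((a, b), (b', c)) = 0 := fun t ht =>
        habc t (Submodule.mem_sup_left ht)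
      have hD : ∀ t ∈ D, B t ((a, b), (b', c)) = 0 := fun t ht =>
        habc t (Submodule.mem_sup_right ht)
      have hbb : b = b' := by
        rw [← sub_eq_zero]
        refine symplecticForm_separating fun y => ?_
        have := hD ((0, y), (y, 0)) ⟨y, rfl⟩
        simp only [hB, relationForm_apply] at this
        rw [← (symplecticForm_isAlt (k := k) n).neg_eq, map_sub, neg_eq_zero]
        simpa [sub_eq_add_neg] using this
      subst hbb
      have ha : (a, b) ∈ L := (mem_lag hL).2 fun x' y' hx' => by
        have := hK ((x', y'), 0) ⟨hx', L'.zero_mem⟩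
        simpa [hB, relationForm_apply, neg_add_eq_zero] using this
      have hc : (b, c) ∈ L' := (mem_lag hL').2 fun x' y' hx' => by
        have := hK (0, (x', y')) ⟨L.zero_mem, hx'⟩
        simpa [hB, relationForm_apply, neg_add_eq_zero] using this
      have := h a c ⟨b, ha, hc⟩
      change B ((a, b), (b, c)) ((x, 0), (0, z)) = 0
      simp [hB, relationForm_apply, this]
    rw [LinearMap.BilinForm.orthogonal_orthogonal hBnd hBalt.isRefl] at h1
    obtain ⟨⟨⟨a, b⟩, b', c⟩, ⟨h2, h3⟩, _, ⟨d, rfl⟩, h4⟩ := Submodule.mem_sup.1 h1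
    have e1 : a + 0 = x := congrArg (fun t => t.1.1) h4
    have e2 : b + d = 0 := congrArg (fun t => t.1.2) h4
    have e3 : b' + d = 0 := congrArg (fun t => t.2.1) h4
    have e4 : c + 0 = z := congrArg (fun t => t.2.2) h4
    rw [add_zero] at e1 e4
    subst e1 e4
    have h7 : b = b' := add_right_cancel (e2.trans e3.symm)
    subst h7
    exact ⟨b, h2, h3⟩

end Lagrangian

section LagrangianProp

variable (k : Type u) [Field k]

theorem symplecticForm_add {m n : ℕ} (x y : Fin (m + n) → k × k) :
    symplecticForm k (m + n) x y
      = symplecticForm k m (fun i => x (Fin.castAdd n i)) (fun i => y (Fin.castAdd n i))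
        + symplecticForm k n (fun i => x (Fin.natAdd m i)) (fun i => y (Fin.natAdd m i)) := by
  simp only [symplecticForm_apply, Fin.sum_univ_add]

/-- The diagonal subspace. -/
def linId (V : Type*) [AddCommGroup V] [Module k V] : Submodule k (V × V) where
  carrier := {x | x.1 = x.2}
  zero_mem' := rfl
  add_mem' := by rintro a b (h : _ = _) (h' : _ = _); change _ + _ = _ + _; rw [h, h']
  smul_mem' := by rintro c a (h : _ = _); change _ • _ = _ • _; rw [h]

variable {k}

/-- The dagger of a linear relation: the opposite relation. -/
def linDagger {V W : Type*} [AddCommGroup V] [Module k V] [AddCommGroup W] [Module k W]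
    (L : Submodule k (V × W)) : Submodule k (W × V) where
  carrier := {x | (x.2, x.1) ∈ L}
  zero_mem' := L.zero_mem
  add_mem' := fun h h' => L.add_mem h h'
  smul_mem' := fun c _ h => L.smul_mem c h

/-- The direct sum of two linear relations between powers of `V`. -/
def linSum {V : Type*} [AddCommGroup V] [Module k V] {m n p q : ℕ}
    (L : Submodule k ((Fin m → V) × (Fin n → V))) (L' : Submodule k ((Fin p → V) × (Fin q → V))) :
    Submodule k ((Fin (m + p) → V) × (Fin (n + q) → V)) where
  carrier := {x | (fun i => x.1 (Fin.castAdd p i), fun i => x.2 (Fin.castAdd q i)) ∈ L ∧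
    (fun i => x.1 (Fin.natAdd m i), fun i => x.2 (Fin.natAdd n i)) ∈ L'}
  zero_mem' := ⟨L.zero_mem, L'.zero_mem⟩
  add_mem' := fun h h' => ⟨L.add_mem h.1 h'.1, L'.add_mem h.2 h'.2⟩
  smul_mem' := fun c _ h => ⟨L.smul_mem c h.1, L'.smul_mem c h.2⟩

variable (k)

/-- The graph of the block swap of `m` and `n` coordinates. -/
def linBraid (V : Type*) [AddCommGroup V] [Module k V] (m n : ℕ) :
    Submodule k ((Fin (m + n) → V) × (Fin (n + m) → V)) where
  carrier := {x | (∀ i, x.1 (Fin.castAdd n i) = x.2 (Fin.natAdd n i)) ∧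
    ∀ i, x.1 (Fin.natAdd m i) = x.2 (Fin.castAdd m i)}
  zero_mem' := ⟨fun _ => rfl, fun _ => rfl⟩
  add_mem' := fun h h' => ⟨fun i => congrArg₂ (· + ·) (h.1 i) (h'.1 i),
    fun i => congrArg₂ (· + ·) (h.2 i) (h'.2 i)⟩
  smul_mem' := fun c _ h => ⟨fun i => congrArg (c • ·) (h.1 i), fun i => congrArg (c • ·) (h.2 i)⟩

variable {k}

theorem isLagrangian_linDagger {m n : ℕ} {L : Submodule k ((Fin m → k × k) × (Fin n → k × k))}
    (hL : IsLagrangian (relationForm k m n) L) :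
    IsLagrangian (relationForm k n m) (linDagger L) :=
  isLagrangian_of (fun _ _ _ _ h h' => ((mem_lag hL).1 h _ _ h').symm)
    (fun _ _ h => (mem_lag hL).2 fun x' y' h' => (h y' x' h').symm)

theorem isLagrangian_linId (n : ℕ) : IsLagrangian (relationForm k n n) (linId k (Fin n → k × k)) :=
  isLagrangian_of (by rintro x y x' y' (rfl : x = y) (rfl : x' = y'); rfl) (fun x y h => by
    change x = y
    rw [← sub_eq_zero]
    refine symplecticForm_separating fun z => ?_
    rw [← (symplecticForm_isAlt n).neg_eq, map_sub, h z z rfl, sub_self, neg_zero])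

theorem isLagrangian_linSum {m n p q : ℕ} {L : Submodule k ((Fin m → k × k) × (Fin n → k × k))}
    {L' : Submodule k ((Fin p → k × k) × (Fin q → k × k))}
    (hL : IsLagrangian (relationForm k m n) L) (hL' : IsLagrangian (relationForm k p q) L') :
    IsLagrangian (relationForm k (m + p) (n + q)) (linSum L L') := by
  refine isLagrangian_of ?_ ?_
  · intro x y x' y' h h'
    rw [symplecticForm_add, symplecticForm_add]
    exact congrArg₂ (· + ·) ((mem_lag hL).1 h.1 _ _ h'.1) ((mem_lag hL').1 h.2 _ _ h'.2)
  · intro x y h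
    constructor
    · refine (mem_lag hL).2 fun x' y' h' => ?_
      have := h (Fin.append x' 0) (Fin.append y' 0) ⟨by simpa using h', by
        simp only [Fin.append_right]; exact L'.zero_mem⟩
      rw [symplecticForm_add, symplecticForm_add] at this
      have e : ∀ n, (fun _ : Fin n => (0 : k × k)) = 0 := fun _ => rfl
      simpa [e] using this
    · refine (mem_lag hL').2 fun x' y' h' => ?_
      have := h (Fin.append 0 x') (Fin.append 0 y') ⟨by
        simp only [Fin.append_left]; exact L.zero_mem, by simpa using h'⟩
      rw [symplecticForm_add, symplecticForm_add] at this
      have e : ∀ n, (fun _ : Fin n => (0 : k × k)) = 0 := fun _ => rfl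
      simpa [e] using this

theorem isLagrangian_linBraid (m n : ℕ) :
    IsLagrangian (relationForm k (m + n) (n + m)) (linBraid k (k × k) m n) := by
  refine isLagrangian_of ?_ ?_
  · intro x y x' y' h h'
    rw [symplecticForm_add, symplecticForm_add]
    have e1 := funext h.1
    have e2 := funext h.2
    have e3 := funext h'.1
    have e4 := funext h'.2
    dsimp only at e1 e2 e3 e4
    rw [e1, e2, e3, e4, add_comm]
  · intro x y h
    have key : ∀ z : Fin (m + n) → k × k, symplecticForm k (m + n) z x
        = symplecticForm k (m + n) z
          (Fin.append (fun i => y (Fin.natAdd n i)) (fun i => y (Fin.castAdd m i))) := by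
      intro z
      rw [h z (Fin.append (fun i => z (Fin.natAdd m i)) (fun i => z (Fin.castAdd n i)))
        ⟨by simp, by simp⟩, symplecticForm_add, symplecticForm_add, add_comm]
      simp
    have e : x = Fin.append (fun i => y (Fin.natAdd n i)) (fun i => y (Fin.castAdd m i)) := by
      rw [← sub_eq_zero]
      refine symplecticForm_separating fun z => ?_
      rw [← (symplecticForm_isAlt _).neg_eq, map_sub, key, sub_self, neg_zero]
    rw [e]
    exact ⟨by simp, by simp⟩

variable (k)

/-- The operations of the dagger prop of linear Lagrangian relations: relational composition,
direct sum, swap and opposite relation. -/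
def lagRelData : DaggerPropData.{u} where
  Hom m n := LagHom k m n
  id n := ⟨linId k (Fin n → k × k), isLagrangian_linId n⟩
  comp L L' := ⟨linComp L.1 L'.1, isLagrangian_linComp L.2 L'.2⟩
  tensor L L' := ⟨linSum L.1 L'.1, isLagrangian_linSum L.2 L'.2⟩
  braid m n := ⟨linBraid k (k × k) m n, isLagrangian_linBraid m n⟩
  dagger L := ⟨linDagger L.1, isLagrangian_linDagger L.2⟩

/-- The dagger prop of linear Lagrangian relations over `k`. -/
def LagRel : DaggerProp.{u} :=
  (lagRelData k).ofEmbedding (relProp (k × k)) (fun L x y => (x, y) ∈ L.1)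
    (fun h => Subtype.ext <| Submodule.ext fun ⟨x, y⟩ =>
      iff_of_eq (congrFun (congrFun h x) y))
    (fun _ => rfl) (fun _ _ => rfl) (fun _ _ => rfl) (fun _ _ => rfl) (fun _ => rfl)

variable {k}

/-! Linear relations between powers of `k`. -/

variable (k)

/-- Addition `+ : k ⊕ k → k`. -/
def addRel : Submodule k ((Fin 2 → k) × (Fin 1 → k)) where
  carrier := {x | x.2 0 = x.1 0 + x.1 1}
  zero_mem' := by simp
  add_mem' := by
    rintro a b (h : _ = _) (h' : _ = _)
    change a.2 0 + b.2 0 = (a.1 0 + b.1 0) + (a.1 1 + b.1 1)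
    rw [h, h', add_add_add_comm]
  smul_mem' := by
    rintro c a (h : _ = _)
    change c * a.2 0 = c * a.1 0 + c * a.1 1
    rw [h, mul_add]

@[simp] theorem mem_addRel {x : Fin 2 → k} {y : Fin 1 → k} :
    (x, y) ∈ addRel k ↔ y 0 = x 0 + x 1 := Iff.rfl

/-- Zero `0 : {0} → k`. -/
def zeroRel : Submodule k ((Fin 0 → k) × (Fin 1 → k)) where
  carrier := {x | x.2 0 = 0}
  zero_mem' := rfl
  add_mem' := by
    rintro a b (h : _ = _) (h' : _ = _)
    change a.2 0 + b.2 0 = 0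
    rw [h, h', add_zero]
  smul_mem' := by
    rintro c a (h : _ = _)
    change c * a.2 0 = 0
    rw [h, mul_zero]

/-- Duplication `Δ : k → k ⊕ k`. -/
def dupRel : Submodule k ((Fin 1 → k) × (Fin 2 → k)) where
  carrier := {x | x.2 0 = x.1 0 ∧ x.2 1 = x.1 0}
  zero_mem' := ⟨rfl, rfl⟩
  add_mem' := fun h h' => ⟨congrArg₂ (· + ·) h.1 h'.1, congrArg₂ (· + ·) h.2 h'.2⟩
  smul_mem' := fun c _ h => ⟨congrArg (c * ·) h.1, congrArg (c * ·) h.2⟩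

/-- Deletion `! : k → {0}`. -/
def delRel : Submodule k ((Fin 1 → k) × (Fin 0 → k)) := ⊤

variable {k}

/-- The direct sum `R ⊕ S` of a linear relation `R` between efforts and a linear relation `S`
between flows, as a linear relation between tuples of pairs (effort, flow). -/
def effortFlow {m n : ℕ} (R S : Submodule k ((Fin m → k) × (Fin n → k))) :
    Submodule k ((Fin m → k × k) × (Fin n → k × k)) where
  carrier := {x | (fun i => (x.1 i).1, fun j => (x.2 j).1) ∈ R ∧
    (fun i => (x.1 i).2, fun j => (x.2 j).2) ∈ S}
  zero_mem' := ⟨R.zero_mem, S.zero_mem⟩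
  add_mem' := fun h h' => ⟨R.add_mem h.1 h'.1, S.add_mem h.2 h'.2⟩
  smul_mem' := fun c _ h => ⟨R.smul_mem c h.1, S.smul_mem c h.2⟩

variable (k)

theorem isLagrangian_add_dup :
    IsLagrangian (relationForm k 2 1) (effortFlow (addRel k) (linDagger (dupRel k))) := by
  refine isLagrangian_of ?_ ?_
  · rintro x y x' y' ⟨h1 : _ = _, h2 : _ = _, h3 : _ = _⟩ ⟨h4 : _ = _, h5 : _ = _, h6 : _ = _⟩
    dsimp only at h1 h2 h3 h4 h5 h6
    simp only [symplecticForm_apply, Fin.sum_univ_two, Fin.sum_univ_one, h1, h2, h3, h4, h5, h6]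
    ring
  · intro x y h
    have e1 := h ![(1, 0), (0, 0)] ![(1, 0)] (by
      refine ⟨?_, ?_, ?_⟩ <;> simp)
    have e2 := h ![(0, 0), (1, 0)] ![(1, 0)] (by
      refine ⟨?_, ?_, ?_⟩ <;> simp)
    have e3 := h ![(0, 1), (0, 1)] ![(0, 1)] (by
      refine ⟨?_, ?_, ?_⟩ <;> simp)
    simp [symplecticForm_apply] at e1 e2 e3
    refine ⟨?_, ?_, ?_⟩
    · change (y 0).1 = (x 0).1 + (x 1).1
      linear_combination e3
    · exact e1
    · exact e2

theorem isLagrangian_zero_del :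
    IsLagrangian (relationForm k 0 1) (effortFlow (zeroRel k) (linDagger (delRel k))) := by
  refine isLagrangian_of ?_ ?_
  · rintro x y x' y' ⟨h1 : _ = _, -⟩ ⟨h4 : _ = _, -⟩
    dsimp only at h1 h4
    simp [symplecticForm_apply, h1, h4]
  · intro x y h
    have e1 := h ![] ![(0, 1)] ⟨rfl, trivial⟩
    simp [symplecticForm_apply] at e1
    exact ⟨e1, trivial⟩

theorem isLagrangian_dup_add :
    IsLagrangian (relationForm k 2 1) (effortFlow (linDagger (dupRel k)) (addRel k)) := by
  refine isLagrangian_of ?_ ?_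
  · rintro x y x' y' ⟨⟨h1 : _ = _, h2 : _ = _⟩, h3 : _ = _⟩ ⟨⟨h4 : _ = _, h5 : _ = _⟩, h6 : _ = _⟩
    dsimp only at h1 h2 h3 h4 h5 h6
    simp only [symplecticForm_apply, Fin.sum_univ_two, Fin.sum_univ_one, h1, h2, h3, h4, h5, h6]
    ring
  · intro x y h
    have e1 := h ![(0, 1), (0, 0)] ![(0, 1)] (by
      refine ⟨⟨?_, ?_⟩, ?_⟩ <;> simp)
    have e2 := h ![(0, 0), (0, 1)] ![(0, 1)] (by
      refine ⟨⟨?_, ?_⟩, ?_⟩ <;> simp)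
    have e3 := h ![(1, 0), (1, 0)] ![(1, 0)] (by
      refine ⟨⟨?_, ?_⟩, ?_⟩ <;> simp)
    simp [symplecticForm_apply] at e1 e2 e3
    refine ⟨⟨?_, ?_⟩, ?_⟩
    · exact e1
    · exact e2
    · change (y 0).2 = (x 0).2 + (x 1).2
      linear_combination -e3

theorem isLagrangian_del_zero :
    IsLagrangian (relationForm k 0 1) (effortFlow (linDagger (delRel k)) (zeroRel k)) := by
  refine isLagrangian_of ?_ ?_
  · rintro x y x' y' ⟨-, h1 : _ = _⟩ ⟨-, h4 : _ = _⟩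
    dsimp only at h1 h4
    simp [symplecticForm_apply, h1, h4]
  · intro x y h
    have e1 := h ![] ![(1, 0)] ⟨trivial, rfl⟩
    simp [symplecticForm_apply] at e1
    exact ⟨trivial, e1.symm⟩

/-- The linear Lagrangian relation `+ ⊕ Δ†`. -/
def addDup : LagHom k 2 1 :=
  ⟨effortFlow (addRel k) (linDagger (dupRel k)), isLagrangian_add_dup k⟩

/-- The linear Lagrangian relation `0 ⊕ !†`. -/
def zeroDel : LagHom k 0 1 :=
  ⟨effortFlow (zeroRel k) (linDagger (delRel k)), isLagrangian_zero_del k⟩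

/-- The linear Lagrangian relation `Δ† ⊕ +`. -/
def dupAdd : LagHom k 2 1 :=
  ⟨effortFlow (linDagger (dupRel k)) (addRel k), isLagrangian_dup_add k⟩

/-- The linear Lagrangian relation `!† ⊕ 0`. -/
def delZero : LagHom k 0 1 :=
  ⟨effortFlow (linDagger (delRel k)) (zeroRel k), isLagrangian_del_zero k⟩

/-- The linear Lagrangian relation `+† ⊕ Δ`. -/
def addDup' : LagHom k 1 2 :=
  ⟨effortFlow (linDagger (addRel k)) (dupRel k), isLagrangian_linDagger (isLagrangian_add_dup k)⟩

/-- The linear Lagrangian relation `0† ⊕ !`. -/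
def zeroDel' : LagHom k 1 0 :=
  ⟨effortFlow (linDagger (zeroRel k)) (delRel k), isLagrangian_linDagger (isLagrangian_zero_del k)⟩

/-- The linear Lagrangian relation `Δ ⊕ +†`. -/
def dupAdd' : LagHom k 1 2 :=
  ⟨effortFlow (dupRel k) (linDagger (addRel k)), isLagrangian_linDagger (isLagrangian_dup_add k)⟩

/-- The linear Lagrangian relation `! ⊕ 0†`. -/
def delZero' : LagHom k 1 0 :=
  ⟨effortFlow (delRel k) (linDagger (zeroRel k)), isLagrangian_linDagger (isLagrangian_del_zero k)⟩

/-- The eight generating linear Lagrangian relations. -/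
inductive IsLagGen : ∀ m n, LagHom k m n → Prop
  | addDup : IsLagGen 2 1 (addDup k)
  | zeroDel : IsLagGen 0 1 (zeroDel k)
  | addDup' : IsLagGen 1 2 (addDup' k)
  | zeroDel' : IsLagGen 1 0 (zeroDel' k)
  | dupAdd : IsLagGen 2 1 (dupAdd k)
  | delZero : IsLagGen 0 1 (delZero k)
  | dupAdd' : IsLagGen 1 2 (dupAdd' k)
  | delZero' : IsLagGen 1 0 (delZero' k)

theorem isLagGen_dagger (m n : ℕ) (f : LagHom k m n) (h : IsLagGen k m n f) :
    IsLagGen k n m ((LagRel k).dagger f) := by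
  cases h
  exacts [.addDup', .zeroDel', .addDup, .zeroDel, .dupAdd', .delZero', .dupAdd, .delZero]

/-- The sub-prop of `LagRel k` generated by the eight linear Lagrangian relations `IsLagGen`. -/
def LagRelO : DaggerProp.{u} := (LagRel k).sub (IsLagGen k) (isLagGen_dagger k)

end LagrangianProp

/-! ### Corelations between multiples of 2 -/

/-- The multiplication `m : 2 → 1` of `FinCorel`: the partition with one part. -/
def corM : FinCorel.Hom 2 1 := (⊤ : Setoid (Fin 2 ⊕ Fin 1))

/-- The unit `i : 0 → 1` of `FinCorel`: the partition with one part. -/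
def corI : FinCorel.Hom 0 1 := (⊤ : Setoid (Fin 0 ⊕ Fin 1))

/-- The comultiplication `d : 1 → 2` of `FinCorel`: the partition with one part. -/
def corD : FinCorel.Hom 1 2 := (⊤ : Setoid (Fin 1 ⊕ Fin 2))

/-- The counit `e : 1 → 0` of `FinCorel`: the partition with one part. -/
def corE : FinCorel.Hom 1 0 := (⊤ : Setoid (Fin 1 ⊕ Fin 0))

/-- `m₂ = id₁ + (e ∘ m) + id₁ : 4 → 2`. -/
def corM₂ : FinCorel.Hom 4 2 :=
  FinCorel.tensor (FinCorel.tensor (FinCorel.id 1) (FinCorel.comp corM corE)) (FinCorel.id 1)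

/-- `i₂ = d ∘ i : 0 → 2`. -/
def corI₂ : FinCorel.Hom 0 2 := FinCorel.comp corI corD

/-- `d₂ = id₁ + (d ∘ i) + id₁ : 2 → 4`. -/
def corD₂ : FinCorel.Hom 2 4 :=
  FinCorel.tensor (FinCorel.tensor (FinCorel.id 1) (FinCorel.comp corI corD)) (FinCorel.id 1)

/-- `e₂ = e ∘ m : 2 → 0`. -/
def corE₂ : FinCorel.Hom 2 0 := FinCorel.comp corM corE

/-- The swap of the middle two of four points. -/
def corSwap : FinCorel.Hom 4 4 :=
  FinCorel.tensor (FinCorel.tensor (FinCorel.id 1) (FinCorel.braid 1 1)) (FinCorel.id 1)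

/-- `μ₂ = (m + m) ∘ (id₁ + B₁₁ + id₁) : 4 → 2`. -/
def corMu₂ : FinCorel.Hom 4 2 := FinCorel.comp corSwap (FinCorel.tensor corM corM)

/-- `ι₂ = i + i : 0 → 2`. -/
def corIota₂ : FinCorel.Hom 0 2 := FinCorel.tensor corI corI

/-- `δ₂ = (id₁ + B₁₁ + id₁) ∘ (d + d) : 2 → 4`. -/
def corDelta₂ : FinCorel.Hom 2 4 := FinCorel.comp (FinCorel.tensor corD corD) corSwap

/-- `ε₂ = e + e : 2 → 0`. -/
def corEps₂ : FinCorel.Hom 2 0 := FinCorel.tensor corE corE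

/-- The eight generating corelations between even numbers.  The even number `2 * n` is the object
`n` of `FinCorel.multiples 2`. -/
inductive IsCorelGen : ∀ m n, (FinCorel.multiples 2).Hom m n → Prop
  | m₂ : IsCorelGen 2 1 corM₂
  | i₂ : IsCorelGen 0 1 corI₂
  | d₂ : IsCorelGen 1 2 corD₂
  | e₂ : IsCorelGen 1 0 corE₂
  | μ₂ : IsCorelGen 2 1 corMu₂
  | ι₂ : IsCorelGen 0 1 corIota₂
  | δ₂ : IsCorelGen 1 2 corDelta₂
  | ε₂ : IsCorelGen 1 0 corEps₂

theorem corM_dagger : FinCorel.dagger corM = corD := rfl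
theorem corI_dagger : FinCorel.dagger corI = corE := rfl
theorem corD_dagger : FinCorel.dagger corD = corM := rfl
theorem corE_dagger : FinCorel.dagger corE = corI := rfl

theorem corSwap_dagger : FinCorel.dagger corSwap = corSwap :=
  (FinCorel.dagger_tensor _ _).trans (congrArg₂ FinCorel.tensor
    ((FinCorel.dagger_tensor _ _).trans
      (congrArg₂ FinCorel.tensor (FinCorel.dagger_id 1) (FinCorel.dagger_braid 1 1)))
    (FinCorel.dagger_id 1))

theorem corI₂_dagger : FinCorel.dagger corI₂ = corE₂ := FinCorel.dagger_comp _ _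

theorem corE₂_dagger : FinCorel.dagger corE₂ = corI₂ := FinCorel.dagger_comp _ _

theorem corM₂_dagger : FinCorel.dagger corM₂ = corD₂ :=
  (FinCorel.dagger_tensor _ _).trans (congrArg₂ FinCorel.tensor
    ((FinCorel.dagger_tensor _ _).trans
      (congrArg₂ FinCorel.tensor (FinCorel.dagger_id 1) corE₂_dagger))
    (FinCorel.dagger_id 1))

theorem corD₂_dagger : FinCorel.dagger corD₂ = corM₂ := by
  rw [← corM₂_dagger, FinCorel.dagger_dagger]

theorem corMu₂_dagger : FinCorel.dagger corMu₂ = corDelta₂ :=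
  (FinCorel.dagger_comp _ _).trans
    (congrArg₂ FinCorel.comp (FinCorel.dagger_tensor _ _) corSwap_dagger)

theorem corDelta₂_dagger : FinCorel.dagger corDelta₂ = corMu₂ := by
  rw [← corMu₂_dagger, FinCorel.dagger_dagger]

theorem corIota₂_dagger : FinCorel.dagger corIota₂ = corEps₂ := FinCorel.dagger_tensor _ _

theorem corEps₂_dagger : FinCorel.dagger corEps₂ = corIota₂ := FinCorel.dagger_tensor _ _

theorem isCorelGen_dagger (m n : ℕ) (f : (FinCorel.multiples 2).Hom m n)
    (h : IsCorelGen m n f) : IsCorelGen n m ((FinCorel.multiples 2).dagger f) := by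
  cases h with
  | m₂ => exact (congrArg (IsCorelGen 1 2) corM₂_dagger).mpr .d₂
  | i₂ => exact (congrArg (IsCorelGen 1 0) corI₂_dagger).mpr .e₂
  | d₂ => exact (congrArg (IsCorelGen 2 1) corD₂_dagger).mpr .m₂
  | e₂ => exact (congrArg (IsCorelGen 0 1) corE₂_dagger).mpr .i₂
  | μ₂ => exact (congrArg (IsCorelGen 1 2) corMu₂_dagger).mpr .δ₂
  | ι₂ => exact (congrArg (IsCorelGen 1 0) corIota₂_dagger).mpr .ε₂
  | δ₂ => exact (congrArg (IsCorelGen 2 1) corDelta₂_dagger).mpr .μ₂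
  | ε₂ => exact (congrArg (IsCorelGen 0 1) corEps₂_dagger).mpr .ι₂

/-- The dagger prop of corelations between even numbers generated by the eight corelations
`IsCorelGen`. -/
def FinCorelO : DaggerProp.{0} := (FinCorel.multiples 2).sub IsCorelGen isCorelGen_dagger

/-! ### Bond graphs -/

/-- The eight generators: the multiplication `M`, unit `I`, comultiplication `D` and counit `E`
given by 1-junctions, and those given by 0-junctions, which carry a prime. -/
inductive Junction : ℕ → ℕ → Type
  | M : Junction 2 1
  | I : Junction 0 1
  | D : Junction 1 2
  | E : Junction 1 0
  | M' : Junction 2 1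
  | I' : Junction 0 1
  | D' : Junction 1 2
  | E' : Junction 1 0

/-- The reflection of generators. -/
def Junction.dagger : ∀ {m n}, Junction m n → Junction n m
  | _, _, .M => .D
  | _, _, .I => .E
  | _, _, .D => .M
  | _, _, .E => .I
  | _, _, .M' => .D'
  | _, _, .I' => .E'
  | _, _, .D' => .M'
  | _, _, .E' => .I'

/-- Formal expressions in the generators and the operations of a prop. -/
inductive Term : ℕ → ℕ → Type
  | gen {m n} : Junction m n → Term m n
  | ident (n) : Term n n
  | comp {m n p} : Term m n → Term n p → Term m p
  | tensor {m n p q} : Term m n → Term p q → Term (m + p) (n + q)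
  | braid (m n) : Term (m + n) (n + m)

namespace Term

/-- The reflection of expressions. -/
def dagger : ∀ {m n}, Term m n → Term n m
  | _, _, gen g => gen g.dagger
  | _, _, ident n => ident n
  | _, _, comp f g => comp g.dagger f.dagger
  | _, _, tensor f g => tensor f.dagger g.dagger
  | _, _, braid m n => braid n m

/-- Transport of an expression along equalities between its source, resp. target, objects. -/
def cast {m n m' n' : ℕ} (h : m = m') (h' : n = n') (f : Term m n) : Term m' n' := h ▸ h' ▸ f

theorem cast_cast {m n m' n' m'' n'' : ℕ} (h : m = m') (h' : n = n') (k : m' = m'')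
    (k' : n' = n'') (f : Term m n) :
    cast k k' (cast h h' f) = cast (h.trans k) (h'.trans k') f := by
  subst h h' k k'; rfl

theorem comp_cast_left {m n p m' n' : ℕ} (h : m = m') (h' : n = n') (f : Term m n)
    (g : Term n' p) : (cast h h' f).comp g = cast h rfl (f.comp (cast h'.symm rfl g)) := by
  subst h h'; rfl

theorem dagger_cast {m n m' n' : ℕ} (h : m = m') (h' : n = n') (f : Term m n) :
    (cast h h' f).dagger = cast h' h f.dagger := by
  subst h h'; rfl

end Term

open Term in
/-- The equations of an extraspecial symmetric Frobenius monoid on the object `1` with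
multiplication `μ`, unit `ι`, comultiplication `δ` and counit `ε`.  The equation `cosymmetric`
follows from the others; it is listed so that the equations are invariant under reflection. -/
inductive FrobeniusEq (μ : Term 2 1) (ι : Term 0 1) (δ : Term 1 2) (ε : Term 1 0) :
    ∀ {m n}, Term m n → Term m n → Prop
  | assoc : FrobeniusEq μ ι δ ε ((μ.tensor (ident 1)).comp μ) (((ident 1).tensor μ).comp μ)
  | unit_left : FrobeniusEq μ ι δ ε ((ι.tensor (ident 1)).comp μ) (ident 1)
  | unit_right : FrobeniusEq μ ι δ ε (((ident 1).tensor ι).comp μ) (ident 1)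
  | coassoc : FrobeniusEq μ ι δ ε (δ.comp (δ.tensor (ident 1))) (δ.comp ((ident 1).tensor δ))
  | counit_left : FrobeniusEq μ ι δ ε (δ.comp (ε.tensor (ident 1))) (ident 1)
  | counit_right : FrobeniusEq μ ι δ ε (δ.comp ((ident 1).tensor ε)) (ident 1)
  | frobenius_left :
      FrobeniusEq μ ι δ ε ((δ.tensor (ident 1)).comp ((ident 1).tensor μ)) (μ.comp δ)
  | frobenius_right :
      FrobeniusEq μ ι δ ε (((ident 1).tensor δ).comp (μ.tensor (ident 1))) (μ.comp δ)
  | special : FrobeniusEq μ ι δ ε (δ.comp μ) (ident 1)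
  | extra : FrobeniusEq μ ι δ ε (ι.comp ε) (ident 0)
  | symmetric : FrobeniusEq μ ι δ ε ((braid 1 1).comp (μ.comp ε)) (μ.comp ε)
  | cosymmetric : FrobeniusEq μ ι δ ε ((ι.comp δ).comp (braid 1 1)) (ι.comp δ)

open Term in
/-- The equations between the monoid `μ`, `ι` and the comonoid `δ`, `ε` of a weak bimonoid. -/
inductive WeakBimonoidEq (μ : Term 2 1) (ι : Term 0 1) (δ : Term 1 2) (ε : Term 1 0) :
    ∀ {m n}, Term m n → Term m n → Prop
  | mul_comul : WeakBimonoidEq μ ι δ ε (μ.comp δ)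
      (((δ.tensor δ).comp (((ident 1).tensor (braid 1 1)).tensor (ident 1))).comp (μ.tensor μ))
  | counit : WeakBimonoidEq μ ι δ ε ((μ.tensor (ident 1)).comp (μ.comp ε))
      ((((ident 1).tensor δ).tensor (ident 1)).comp ((μ.comp ε).tensor (μ.comp ε)))
  | counit' : WeakBimonoidEq μ ι δ ε ((μ.tensor (ident 1)).comp (μ.comp ε))
      ((((ident 1).tensor (δ.comp (braid 1 1))).tensor (ident 1)).comp
        ((μ.comp ε).tensor (μ.comp ε)))
  | unit : WeakBimonoidEq μ ι δ ε ((ι.comp δ).comp (δ.tensor (ident 1)))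
      (((ι.comp δ).tensor (ι.comp δ)).comp (((ident 1).tensor μ).tensor (ident 1)))
  | unit' : WeakBimonoidEq μ ι δ ε ((ι.comp δ).comp (δ.tensor (ident 1)))
      (((ι.comp δ).tensor (ι.comp δ)).comp
        (((ident 1).tensor ((braid 1 1).comp μ)).tensor (ident 1)))

namespace Term

/-- The generators as expressions. -/
abbrev M : Term 2 1 := gen .M
abbrev I : Term 0 1 := gen .I
abbrev D : Term 1 2 := gen .D
abbrev E : Term 1 0 := gen .E
abbrev M' : Term 2 1 := gen .M'
abbrev I' : Term 0 1 := gen .I'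
abbrev D' : Term 1 2 := gen .D'
abbrev E' : Term 1 0 := gen .E'

/-- `M' ∘ D ∘ M ∘ D'`. -/
def loop : Term 1 1 := (D'.comp M).comp (D.comp M')

/-- `M ∘ D' ∘ M' ∘ D`. -/
def loop' : Term 1 1 := (D.comp M').comp (D'.comp M)

end Term

open Term in
/-- The defining equations of the prop of bond graphs.  The monoid and comonoid laws of the two
weak bimonoids `M, I, D', E'` and `M', I', D, E` are among the equations of the two Frobenius
monoids. -/
inductive BondEq : ∀ {m n}, Term m n → Term m n → Prop
  | frobenius {m n} (t u : Term m n) : FrobeniusEq M I D E t u → BondEq t u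
  | frobenius' {m n} (t u : Term m n) : FrobeniusEq M' I' D' E' t u → BondEq t u
  | weakBimonoid {m n} (t u : Term m n) : WeakBimonoidEq M I D' E' t u → BondEq t u
  | weakBimonoid' {m n} (t u : Term m n) : WeakBimonoidEq M' I' D E t u → BondEq t u
  | extra : BondEq (I'.comp E) (ident 0)
  | extra' : BondEq (I.comp E') (ident 0)
  | idem : BondEq (loop.comp loop) loop
  | idem' : BondEq (loop'.comp loop') loop'

open Term in
/-- The congruence on expressions generated by the laws of a prop and the equations `BondEq`. -/
inductive BondRel : ∀ {m n}, Term m n → Term m n → Prop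
  | refl {m n} (f : Term m n) : BondRel f f
  | symm {m n} {f g : Term m n} : BondRel f g → BondRel g f
  | trans {m n} {f g h : Term m n} : BondRel f g → BondRel g h → BondRel f h
  | comp {m n p} {f f' : Term m n} {g g' : Term n p} :
      BondRel f f' → BondRel g g' → BondRel (f.comp g) (f'.comp g')
  | tensor {m n p q} {f f' : Term m n} {g g' : Term p q} :
      BondRel f f' → BondRel g g' → BondRel (f.tensor g) (f'.tensor g')
  | id_comp {m n} (f : Term m n) : BondRel ((ident m).comp f) f
  | comp_id {m n} (f : Term m n) : BondRel (f.comp (ident n)) f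
  | comp_assoc {m n p q} (f : Term m n) (g : Term n p) (h : Term p q) :
      BondRel ((f.comp g).comp h) (f.comp (g.comp h))
  | id_tensor_id (m n) : BondRel ((ident m).tensor (ident n)) (ident (m + n))
  | interchange {m n p m' n' p'} (f : Term m n) (g : Term n p) (f' : Term m' n')
      (g' : Term n' p') :
      BondRel ((f.comp g).tensor (f'.comp g')) ((f.tensor f').comp (g.tensor g'))
  | tensor_assoc {m n p q r s} (f : Term m n) (g : Term p q) (h : Term r s) :
      BondRel (Term.cast (Nat.add_assoc m p r) (Nat.add_assoc n q s) ((f.tensor g).tensor h))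
        (f.tensor (g.tensor h))
  | id_tensor {m n} (f : Term m n) :
      BondRel (Term.cast (Nat.zero_add m) (Nat.zero_add n) ((ident 0).tensor f)) f
  | tensor_id_zero {m n} (f : Term m n) :
      BondRel (Term.cast (Nat.add_zero m) (Nat.add_zero n) (f.tensor (ident 0))) f
  | braid_natural {m n p q} (f : Term m n) (g : Term p q) :
      BondRel ((f.tensor g).comp (braid n q)) ((braid m p).comp (g.tensor f))
  | braid_braid (m n) : BondRel ((braid m n).comp (braid n m)) (ident (m + n))
  | hexagon (m n p) :
      BondRel (Term.cast (Nat.add_assoc m n p) (Nat.add_assoc n p m).symm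
        (((braid m n).tensor (ident p)).comp
          (Term.cast (Nat.add_assoc n m p).symm rfl ((ident n).tensor (braid m p)))))
        (braid m (n + p))
  | hexagon' (m n p) :
      BondRel (Term.cast (Nat.add_assoc m n p).symm (Nat.add_assoc p m n)
        (((ident m).tensor (braid n p)).comp
          (Term.cast (Nat.add_assoc m p n) rfl ((braid m p).tensor (ident n)))))
        (braid (m + n) p)
  | eqn {m n} {f g : Term m n} : BondEq f g → BondRel f g

theorem Junction.dagger_dagger {m n : ℕ} (g : Junction m n) : g.dagger.dagger = g := by
  cases g <;> rfl

theorem Term.dagger_dagger {m n : ℕ} (f : Term m n) : f.dagger.dagger = f := by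
  induction f with
  | gen g => simp [dagger, Junction.dagger_dagger]
  | ident n => rfl
  | comp f g hf hg => simp [dagger, hf, hg]
  | tensor f g hf hg => simp [dagger, hf, hg]
  | braid m n => rfl

namespace BondRel

open Term

theorem cast {m n m' n' : ℕ} (h : m = m') (h' : n = n') {f g : Term m n} (r : BondRel f g) :
    BondRel (Term.cast h h' f) (Term.cast h h' g) := by
  subst h h'; exact r

theorem of_eq {m n : ℕ} {f g : Term m n} (h : f = g) : BondRel f g := h ▸ refl f

theorem frobenius_dagger {μ : Term 2 1} {ι : Term 0 1} {δ : Term 1 2} {ε : Term 1 0}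
    (hμ : μ.dagger = δ) (hι : ι.dagger = ε) (hδ : δ.dagger = μ) (hε : ε.dagger = ι)
    (H : ∀ {m n} {t u : Term m n}, FrobeniusEq μ ι δ ε t u → BondRel t u)
    {m n : ℕ} {t u : Term m n} (h : FrobeniusEq μ ι δ ε t u) : BondRel t.dagger u.dagger := by
  cases h <;> simp only [dagger, hμ, hι, hδ, hε]
  · exact H .coassoc
  · exact H .counit_left
  · exact H .counit_right
  · exact H .assoc
  · exact H .unit_left
  · exact H .unit_right
  · exact H .frobenius_right
  · exact H .frobenius_left
  · exact H .special
  · exact H .extra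
  · exact H .cosymmetric
  · exact H .symmetric

theorem weakBimonoid_dagger {μ μ' : Term 2 1} {ι ι' : Term 0 1} {δ δ' : Term 1 2}
    {ε ε' : Term 1 0} (hμ : μ.dagger = δ') (hι : ι.dagger = ε') (hδ : δ.dagger = μ')
    (hε : ε.dagger = ι')
    (H : ∀ {m n} {t u : Term m n}, WeakBimonoidEq μ' ι' δ' ε' t u → BondRel t u)
    {m n : ℕ} {t u : Term m n} (h : WeakBimonoidEq μ ι δ ε t u) :
    BondRel t.dagger u.dagger := by
  cases h <;> simp only [dagger, hμ, hι, hδ, hε]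
  · exact (H .mul_comul).trans (comp_assoc _ _ _)
  · exact H .unit
  · exact H .unit'
  · exact H .counit
  · exact H .counit'

theorem bondEq_dagger {m n : ℕ} {f g : Term m n} (h : BondEq f g) :
    BondRel f.dagger g.dagger := by
  cases h with
  | frobenius _ _ h =>
    exact frobenius_dagger rfl rfl rfl rfl (fun h => eqn (.frobenius _ _ h)) h
  | frobenius' _ _ h =>
    exact frobenius_dagger rfl rfl rfl rfl (fun h => eqn (.frobenius' _ _ h)) h
  | weakBimonoid _ _ h =>
    exact weakBimonoid_dagger (μ' := M') (ι' := I') (δ' := D) (ε' := E) rfl rfl rfl rfl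
      (fun h => eqn (.weakBimonoid' _ _ h)) h
  | weakBimonoid' _ _ h =>
    exact weakBimonoid_dagger (μ' := M) (ι' := I) (δ' := D') (ε' := E') rfl rfl rfl rfl
      (fun h => eqn (.weakBimonoid _ _ h)) h
  | extra => exact eqn .extra'
  | extra' => exact eqn .extra
  | idem => exact eqn .idem
  | idem' => exact eqn .idem'

theorem dagger {m n : ℕ} {f g : Term m n} (h : BondRel f g) : BondRel f.dagger g.dagger := by
  induction h with
  | refl f => exact refl _
  | symm _ h => exact h.symm
  | trans _ _ h h' => exact h.trans h'
  | comp _ _ h h' => exact h'.comp h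
  | tensor _ _ h h' => exact h.tensor h'
  | id_comp f => exact comp_id _
  | comp_id f => exact id_comp _
  | comp_assoc f g h => exact (comp_assoc _ _ _).symm
  | id_tensor_id m n => exact id_tensor_id m n
  | interchange f g f' g' => exact interchange _ _ _ _
  | tensor_assoc f g h =>
    exact (of_eq (Term.dagger_cast _ _ _)).trans (tensor_assoc _ _ _)
  | id_tensor f => exact (of_eq (Term.dagger_cast _ _ _)).trans (id_tensor _)
  | tensor_id_zero f => exact (of_eq (Term.dagger_cast _ _ _)).trans (tensor_id_zero _)
  | braid_natural f g => exact (braid_natural _ _).symm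
  | braid_braid m n => exact braid_braid _ _
  | hexagon m n p =>
    refine (of_eq ?_).trans (hexagon' n p m)
    simp only [Term.dagger_cast, Term.dagger, Term.comp_cast_left, Term.cast_cast]
  | hexagon' m n p =>
    refine (of_eq ?_).trans (hexagon p m n)
    simp only [Term.dagger_cast, Term.dagger, Term.comp_cast_left, Term.cast_cast]
  | eqn h => exact bondEq_dagger h

end BondRel

/-- Expressions up to the congruence `BondRel`. -/
instance bondSetoid (m n : ℕ) : Setoid (Term m n) where
  r := BondRel
  iseqv := ⟨BondRel.refl, BondRel.symm, BondRel.trans⟩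

/-- The operations on bond graphs, induced by those on expressions. -/
def bondGraphData : DaggerPropData.{0} where
  Hom m n := Quotient (bondSetoid m n)
  id n := ⟦Term.ident n⟧
  comp := Quotient.map₂ Term.comp fun _ _ h _ _ h' => BondRel.comp h h'
  tensor := Quotient.map₂ Term.tensor fun _ _ h _ _ h' => BondRel.tensor h h'
  braid m n := ⟦Term.braid m n⟧
  dagger := Quotient.map Term.dagger fun _ _ h => BondRel.dagger h

theorem bondGraphData_cast {m n m' n' : ℕ} (h : m = m') (h' : n = n') (f : Term m n) :
    bondGraphData.cast h h' (⟦f⟧ : Quotient (bondSetoid m n))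
      = (⟦Term.cast h h' f⟧ : Quotient (bondSetoid m' n')) := by
  subst h h'; rfl

/-- The dagger prop of bond graphs: generated by the eight morphisms `Junction`, subject to the
equations `BondEq`, with the dagger determined by `M† = D`, `I† = E`, `M'† = D'`, `I'† = E'`. -/
def BondGraph : DaggerProp.{0} where
  toDaggerPropData := bondGraphData
  id_comp := by rintro m n ⟨f⟩; exact Quotient.sound (BondRel.id_comp f)
  comp_id := by rintro m n ⟨f⟩; exact Quotient.sound (BondRel.comp_id f)
  comp_assoc := by
    rintro m n p q ⟨f⟩ ⟨g⟩ ⟨h⟩; exact Quotient.sound (BondRel.comp_assoc f g h)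
  id_tensor_id m n := Quotient.sound (BondRel.id_tensor_id m n)
  interchange := by
    rintro m n p m' n' p' ⟨f⟩ ⟨g⟩ ⟨f'⟩ ⟨g'⟩; exact Quotient.sound (BondRel.interchange f g f' g')
  tensor_assoc := by
    rintro m n p q r s ⟨f⟩ ⟨g⟩ ⟨h⟩
    exact (bondGraphData_cast _ _ _).trans (Quotient.sound (BondRel.tensor_assoc f g h))
  id_tensor := by
    rintro m n ⟨f⟩
    exact (bondGraphData_cast _ _ _).trans (Quotient.sound (BondRel.id_tensor f))
  tensor_id_zero := by
    rintro m n ⟨f⟩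
    exact (bondGraphData_cast _ _ _).trans (Quotient.sound (BondRel.tensor_id_zero f))
  braid_natural := by
    rintro m n p q ⟨f⟩ ⟨g⟩; exact Quotient.sound (BondRel.braid_natural f g)
  braid_braid m n := Quotient.sound (BondRel.braid_braid m n)
  hexagon m n p := by
    refine (congrArg (fun t => bondGraphData.cast _ _ (bondGraphData.comp _ t))
      (bondGraphData_cast _ _ _)).trans ?_
    exact (bondGraphData_cast _ _ _).trans (Quotient.sound (BondRel.hexagon m n p))
  hexagon' m n p := by
    refine (congrArg (fun t => bondGraphData.cast _ _ (bondGraphData.comp _ t))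
      (bondGraphData_cast _ _ _)).trans ?_
    exact (bondGraphData_cast _ _ _).trans (Quotient.sound (BondRel.hexagon' m n p))
  dagger_id n := rfl
  dagger_comp := by rintro m n p ⟨f⟩ ⟨g⟩; rfl
  dagger_dagger := by
    rintro m n ⟨f⟩; exact congrArg (Quotient.mk _) f.dagger_dagger
  dagger_tensor := by rintro m n p q ⟨f⟩ ⟨g⟩; rfl
  dagger_braid m n := rfl

/-- A generator as a bond graph. -/
def BondGraph.of {m n : ℕ} (g : Junction m n) : BondGraph.Hom m n :=
  (⟦Term.gen g⟧ : Quotient (bondSetoid m n))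

/-! ### The morphisms in the statement -/

/-- `m₂` as a morphism of `FinCorelO`. -/
def FinCorelO.m₂ : FinCorelO.Hom 2 1 := ⟨corM₂, .gen _ .m₂⟩

/-- `i₂` as a morphism of `FinCorelO`. -/
def FinCorelO.i₂ : FinCorelO.Hom 0 1 := ⟨corI₂, .gen _ .i₂⟩

/-- `μ₂` as a morphism of `FinCorelO`. -/
def FinCorelO.μ₂ : FinCorelO.Hom 2 1 := ⟨corMu₂, .gen _ .μ₂⟩

/-- `ι₂` as a morphism of `FinCorelO`. -/
def FinCorelO.ι₂ : FinCorelO.Hom 0 1 := ⟨corIota₂, .gen _ .ι₂⟩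

/-- `+ ⊕ Δ†` as a morphism of `LagRelO k`. -/
def LagRelO.addDup (k : Type u) [Field k] : (LagRelO k).Hom 2 1 :=
  ⟨BondGraphs.addDup k, .gen _ .addDup⟩

/-- `0 ⊕ !†` as a morphism of `LagRelO k`. -/
def LagRelO.zeroDel (k : Type u) [Field k] : (LagRelO k).Hom 0 1 :=
  ⟨BondGraphs.zeroDel k, .gen _ .zeroDel⟩

/-- `Δ† ⊕ +` as a morphism of `LagRelO k`. -/
def LagRelO.dupAdd (k : Type u) [Field k] : (LagRelO k).Hom 2 1 :=
  ⟨BondGraphs.dupAdd k, .gen _ .dupAdd⟩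

/-- `!† ⊕ 0` as a morphism of `LagRelO k`. -/
def LagRelO.delZero (k : Type u) [Field k] : (LagRelO k).Hom 0 1 :=
  ⟨BondGraphs.delZero k, .gen _ .delZero⟩

end BondGraphs

/-!
A morphism of dagger props out of `BondGraph` is determined by arbitrary values of `M`, `I`, `M'`,
`I'` that satisfy the defining equations, and these equations can be checked after a faithful
morphism, here into a prop of relations.  Among relations there is a uniform reason for them to
hold: in the arrows of any nonempty groupoid, composition together with copying of arrows satisfies
all of them.  The equations are invariant under the dagger, so the roles of the two families of
junctions may also be exchanged.

A corelation is determined by the families of truth values constant on its parts; with two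
consecutive truth values regarded as one arrow, `m₂` and `i₂` are composition and identities of the
pair groupoid of `Prop`, while `μ₂` and `ι₂` copy and delete its arrows.  A generator of `LagRelO k`
is the product of a relation between efforts and one between flows: for the efforts these are
addition and copying in the additive group of `k`, for the flows the same with exchanged roles.
-/

universe w

namespace BondGraphs

section UniversalProperty

variable {P : DaggerProp.{u}} {Q : DaggerProp.{v}}

attribute [ext] DaggerPropHom

/-- Values in a dagger prop for the generators `M`, `I`, `M'`, `I'`.  The values of `D`, `E`, `D'`,
`E'` are not recorded, since a morphism of dagger props sends them to the daggers of these. -/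
@[ext]
structure JunctionData (P : DaggerProp.{u}) where
  M : P.Hom 2 1
  I : P.Hom 0 1
  M' : P.Hom 2 1
  I' : P.Hom 0 1

namespace JunctionData

/-- The value of each of the eight generators. -/
def value (J : JunctionData P) : ∀ {m n}, Junction m n → P.Hom m n
  | _, _, .M => J.M
  | _, _, .I => J.I
  | _, _, .D => P.dagger J.M
  | _, _, .E => P.dagger J.I
  | _, _, .M' => J.M'
  | _, _, .I' => J.I'
  | _, _, .D' => P.dagger J.M'
  | _, _, .E' => P.dagger J.I'

theorem value_dagger (J : JunctionData P) {m n : ℕ} (j : Junction m n) :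
    J.value j.dagger = P.dagger (J.value j) := by
  cases j <;> simp only [Junction.dagger, value, P.dagger_dagger]

/-- The value of a formal expression in the generators. -/
def eval (J : JunctionData P) : ∀ {m n}, Term m n → P.Hom m n
  | _, _, .gen j => J.value j
  | _, _, .ident n => P.id n
  | _, _, .comp s t => P.comp (J.eval s) (J.eval t)
  | _, _, .tensor s t => P.tensor (J.eval s) (J.eval t)
  | _, _, .braid m n => P.braid m n

theorem eval_cast (J : JunctionData P) {m n m' n' : ℕ} (h : m = m') (h' : n = n')
    (t : Term m n) : J.eval (t.cast h h') = P.cast h h' (J.eval t) := by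
  subst h h'; rfl

theorem eval_dagger (J : JunctionData P) {m n : ℕ} (t : Term m n) :
    J.eval t.dagger = P.dagger (J.eval t) := by
  induction t with
  | gen j => exact J.value_dagger j
  | ident n => exact (P.dagger_id n).symm
  | comp s t hs ht => simp only [Term.dagger, eval, P.dagger_comp, hs, ht]
  | tensor s t hs ht => simp only [Term.dagger, eval, P.dagger_tensor, hs, ht]
  | braid m n => exact (P.dagger_braid m n).symm

/-- The image of values of the generators under a morphism of dagger props. -/
def map (Φ : DaggerPropHom P Q) (J : JunctionData P) : JunctionData Q where
  M := Φ.map J.M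
  I := Φ.map J.I
  M' := Φ.map J.M'
  I' := Φ.map J.I'

theorem eval_map (Φ : DaggerPropHom P Q) (J : JunctionData P) {m n : ℕ} (t : Term m n) :
    (J.map Φ).eval t = Φ.map (J.eval t) := by
  induction t with
  | gen j => cases j <;> simp only [eval, value, map, Φ.map_dagger]
  | ident n => exact (Φ.map_id n).symm
  | comp s t hs ht => simp only [eval, Φ.map_comp, hs, ht]
  | tensor s t hs ht => simp only [eval, Φ.map_tensor, hs, ht]
  | braid m n => exact (Φ.map_braid m n).symm

/-- Values of the generators that satisfy the defining equations of bond graphs. -/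
def IsModel (J : JunctionData P) : Prop :=
  ∀ ⦃m n : ℕ⦄ ⦃s t : Term m n⦄, BondEq s t → J.eval s = J.eval t

theorem IsModel.eval_eq_of_bondRel {J : JunctionData P} (hJ : J.IsModel) {m n : ℕ}
    {s t : Term m n} (h : BondRel s t) : J.eval s = J.eval t := by
  induction h with
  | refl f => rfl
  | symm _ h => exact h.symm
  | trans _ _ h h' => exact h.trans h'
  | comp _ _ h h' => simp only [eval, h, h']
  | tensor _ _ h h' => simp only [eval, h, h']
  | id_comp f => exact P.id_comp _
  | comp_id f => exact P.comp_id _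
  | comp_assoc f g h => exact P.comp_assoc _ _ _
  | id_tensor_id m n => exact P.id_tensor_id m n
  | interchange f g f' g' => exact P.interchange _ _ _ _
  | tensor_assoc f g h => exact (J.eval_cast _ _ _).trans (P.tensor_assoc _ _ _)
  | id_tensor f => exact (J.eval_cast _ _ _).trans (P.id_tensor _)
  | tensor_id_zero f => exact (J.eval_cast _ _ _).trans (P.tensor_id_zero _)
  | braid_natural f g => exact P.braid_natural _ _
  | braid_braid m n => exact P.braid_braid m n
  | hexagon m n p => simpa only [eval_cast, eval] using P.hexagon m n p
  | hexagon' m n p => simpa only [eval_cast, eval] using P.hexagon' m n p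
  | eqn h => exact hJ h

end JunctionData

/-- The generators of `BondGraph`. -/
def BondGraph.junctions : JunctionData BondGraph :=
  ⟨of .M, of .I, of .M', of .I'⟩

theorem BondGraph.eval_junctions {m n : ℕ} (t : Term m n) :
    junctions.eval t = (⟦t⟧ : Quotient (bondSetoid m n)) := by
  induction t with
  | gen j => cases j <;> rfl
  | ident n => rfl
  | comp s t hs ht => exact congrArg₂ BondGraph.comp hs ht
  | tensor s t hs ht => exact congrArg₂ BondGraph.tensor hs ht
  | braid m n => rfl

/-- The morphism of dagger props out of `BondGraph` determined by a model. -/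
def JunctionData.IsModel.hom {J : JunctionData P} (hJ : J.IsModel) : DaggerPropHom BondGraph P where
  map {m n} := Quotient.lift (s := bondSetoid m n) J.eval fun _ _ h => hJ.eval_eq_of_bondRel h
  map_id _ := rfl
  map_comp := by rintro m n p ⟨f⟩ ⟨g⟩; rfl
  map_tensor := by rintro m n p q ⟨f⟩ ⟨g⟩; rfl
  map_braid _ _ := rfl
  map_dagger := by rintro m n ⟨f⟩; exact J.eval_dagger f

theorem JunctionData.IsModel.existsUnique_hom {J : JunctionData P} (hJ : J.IsModel) :
    ∃! Φ : DaggerPropHom BondGraph P, BondGraph.junctions.map Φ = J := by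
  refine ⟨hJ.hom, rfl, fun Φ hΦ => ?_⟩
  ext m n f
  obtain ⟨t, rfl⟩ := Quotient.exists_rep f
  calc Φ.map ⟦t⟧ = Φ.map (BondGraph.junctions.eval t) := by rw [BondGraph.eval_junctions]
    _ = (BondGraph.junctions.map Φ).eval t := (JunctionData.eval_map Φ _ t).symm
    _ = J.eval t := by rw [hΦ]

end UniversalProperty

section Faithful

variable {P : DaggerProp.{u}} {Q : DaggerProp.{v}} {R : DaggerProp.{w}}

namespace DaggerPropHom

/-- A morphism of dagger props that is injective on morphisms. -/
def Faithful (Φ : DaggerPropHom P Q) : Prop :=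
  ∀ m n, Function.Injective (Φ.map : P.Hom m n → Q.Hom m n)

/-- The composite of morphisms of dagger props, in diagrammatic order. -/
def comp (Φ : DaggerPropHom P Q) (Ψ : DaggerPropHom Q R) : DaggerPropHom P R where
  map f := Ψ.map (Φ.map f)
  map_id n := by rw [Φ.map_id, Ψ.map_id]
  map_comp f g := by rw [Φ.map_comp, Ψ.map_comp]
  map_tensor f g := by rw [Φ.map_tensor, Ψ.map_tensor]
  map_braid m n := by rw [Φ.map_braid, Ψ.map_braid]
  map_dagger f := by rw [Φ.map_dagger, Ψ.map_dagger]

theorem Faithful.comp {Φ : DaggerPropHom P Q} {Ψ : DaggerPropHom Q R} (hΦ : Φ.Faithful)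
    (hΨ : Ψ.Faithful) : (Φ.comp Ψ).Faithful :=
  fun m n => (hΨ m n).comp (hΦ m n)

theorem map_cast (Φ : DaggerPropHom P Q) {m n m' n' : ℕ} (h : m = m') (h' : n = n')
    (f : P.Hom m n) : Φ.map (P.cast h h' f) = Q.cast h h' (Φ.map f) := by
  subst h h'; rfl

/-- The morphism induced between the props of multiples of an object. -/
def multiples (Φ : DaggerPropHom P Q) (c : ℕ) :
    DaggerPropHom (P.multiples c) (Q.multiples c) where
  map {m n} f := Φ.map (m := c * m) (n := c * n) f
  map_id _ := Φ.map_id _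
  map_comp _ _ := Φ.map_comp _ _
  map_tensor _ _ := (Φ.map_cast _ _ _).trans (congrArg (Q.cast _ _) (Φ.map_tensor _ _))
  map_braid _ _ := (Φ.map_cast _ _ _).trans (congrArg (Q.cast _ _) (Φ.map_braid _ _))
  map_dagger _ := Φ.map_dagger _

theorem Faithful.multiples {Φ : DaggerPropHom P Q} (hΦ : Φ.Faithful) (c : ℕ) :
    (Φ.multiples c).Faithful :=
  fun _ _ => hΦ _ _

/-- The morphism from the dagger prop `DaggerPropData.ofEmbedding` to the one it is embedded in. -/
def ofEmbedding {D : DaggerPropData.{u}} {P : DaggerProp.{v}}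
    {φ : ∀ {m n}, D.Hom m n → P.Hom m n} {inj : ∀ {m n} {f g : D.Hom m n}, φ f = φ g → f = g}
    {φ_id : ∀ n, φ (D.id n) = P.id n}
    {φ_comp : ∀ {m n p} (f : D.Hom m n) (g : D.Hom n p), φ (D.comp f g) = P.comp (φ f) (φ g)}
    {φ_tensor : ∀ {m n p q} (f : D.Hom m n) (g : D.Hom p q),
      φ (D.tensor f g) = P.tensor (φ f) (φ g)}
    {φ_braid : ∀ m n, φ (D.braid m n) = P.braid m n}
    {φ_dagger : ∀ {m n} (f : D.Hom m n), φ (D.dagger f) = P.dagger (φ f)} :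
    DaggerPropHom (D.ofEmbedding P φ @inj φ_id @φ_comp @φ_tensor φ_braid @φ_dagger) P where
  map := φ
  map_id := φ_id
  map_comp := φ_comp
  map_tensor := φ_tensor
  map_braid := φ_braid
  map_dagger := φ_dagger

end DaggerPropHom

/-- The inclusion of a sub-prop. -/
def DaggerProp.subIncl (P : DaggerProp.{u}) (S : ∀ m n, P.Hom m n → Prop)
    (hS : ∀ m n f, S m n f → S n m (P.dagger f)) : DaggerPropHom (P.sub S hS) P :=
  .ofEmbedding

theorem DaggerProp.subIncl_faithful (P : DaggerProp.{u}) (S : ∀ m n, P.Hom m n → Prop)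
    (hS : ∀ m n f, S m n f → S n m (P.dagger f)) : (P.subIncl S hS).Faithful :=
  fun _ _ => Subtype.val_injective

/-- A corelation as the relation between the families of truth values constant on its parts. -/
def FinCorel.toRel : DaggerPropHom FinCorel (relProp Prop) :=
  .ofEmbedding

theorem FinCorel.toRel_faithful : FinCorel.toRel.Faithful :=
  fun _ _ _ _ => finCorelInv_injective

/-- A Lagrangian relation as a relation. -/
def LagRel.toRel (k : Type u) [Field k] : DaggerPropHom (LagRel k) (relProp (k × k)) :=
  .ofEmbedding

theorem LagRel.toRel_faithful (k : Type u) [Field k] : (LagRel.toRel k).Faithful :=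
  fun _ _ _ _ h => Subtype.ext <| Submodule.ext fun ⟨x, y⟩ => iff_of_eq (congrFun₂ h x y)

theorem JunctionData.IsModel.of_map {Φ : DaggerPropHom P Q} (hΦ : Φ.Faithful)
    {J : JunctionData P} (hJ : (J.map Φ).IsModel) : J.IsModel := by
  intro m n s t h
  apply hΦ
  rw [← eval_map, ← eval_map, hJ h]

end Faithful

section FrobeniusMonoids

variable {P : DaggerProp.{u}}

/-- An extraspecial symmetric Frobenius monoid in a dagger prop whose comonoid is the dagger of its
monoid.  Of each pair of equations exchanged by the dagger only one is recorded. -/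
structure IsDaggerFrobenius (P : DaggerProp.{u}) (μ : P.Hom 2 1) (ι : P.Hom 0 1) : Prop where
  assoc : P.comp (P.tensor μ (P.id 1)) μ = P.comp (P.tensor (P.id 1) μ) μ
  unit_left : P.comp (P.tensor ι (P.id 1)) μ = P.id 1
  unit_right : P.comp (P.tensor (P.id 1) ι) μ = P.id 1
  frobenius : P.comp (P.tensor (P.dagger μ) (P.id 1)) (P.tensor (P.id 1) μ :) =
    (P.comp μ (P.dagger μ) :)
  special : P.comp (P.dagger μ) μ = P.id 1
  extra : P.comp ι (P.dagger ι) = P.id 0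
  symmetric : P.comp (P.braid 1 1) (P.comp μ (P.dagger ι) :) = P.comp μ (P.dagger ι)

/-- The equations of `WeakBimonoidEq` for a monoid `μ`, `ι` and a comonoid `δ`, `ε` in a dagger
prop. -/
structure IsWeakBimonoid (P : DaggerProp.{u}) (μ : P.Hom 2 1) (ι : P.Hom 0 1) (δ : P.Hom 1 2)
    (ε : P.Hom 1 0) : Prop where
  mul_comul : P.comp μ δ =
    P.comp (P.comp (P.tensor δ δ) (P.tensor (P.tensor (P.id 1) (P.braid 1 1)) (P.id 1) :))
      (P.tensor μ μ :)
  counit : P.comp (P.tensor μ (P.id 1)) (P.comp μ ε :) =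
    P.comp (P.tensor (P.tensor (P.id 1) δ) (P.id 1)) (P.tensor (P.comp μ ε) (P.comp μ ε) :)
  counit' : P.comp (P.tensor μ (P.id 1)) (P.comp μ ε :) =
    P.comp (P.tensor (P.tensor (P.id 1) (P.comp δ (P.braid 1 1))) (P.id 1))
      (P.tensor (P.comp μ ε) (P.comp μ ε) :)
  unit : P.comp (P.comp ι δ) (P.tensor δ (P.id 1)) =
    P.comp (P.tensor (P.comp ι δ) (P.comp ι δ)) (P.tensor (P.tensor (P.id 1) μ) (P.id 1) :)
  unit' : P.comp (P.comp ι δ) (P.tensor δ (P.id 1)) =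
    P.comp (P.tensor (P.comp ι δ) (P.comp ι δ))
      (P.tensor (P.tensor (P.id 1) (P.comp (P.braid 1 1) μ :)) (P.id 1) :)

theorem IsWeakBimonoid.dagger {μ : P.Hom 2 1} {ι : P.Hom 0 1} {δ : P.Hom 1 2} {ε : P.Hom 1 0}
    (h : IsWeakBimonoid P μ ι δ ε) :
    IsWeakBimonoid P (P.dagger δ) (P.dagger ε) (P.dagger μ) (P.dagger ι) where
  mul_comul := by
    simpa only [P.dagger_comp, P.dagger_tensor, P.dagger_braid, P.dagger_id, P.comp_assoc]
      using congrArg P.dagger h.mul_comul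
  counit := by
    simpa only [P.dagger_comp, P.dagger_tensor, P.dagger_braid, P.dagger_id, P.comp_assoc]
      using congrArg P.dagger h.unit
  counit' := by
    simpa only [P.dagger_comp, P.dagger_tensor, P.dagger_braid, P.dagger_id, P.comp_assoc]
      using congrArg P.dagger h.unit'
  unit := by
    simpa only [P.dagger_comp, P.dagger_tensor, P.dagger_braid, P.dagger_id, P.comp_assoc]
      using congrArg P.dagger h.counit
  unit' := by
    simpa only [P.dagger_comp, P.dagger_tensor, P.dagger_braid, P.dagger_id, P.comp_assoc]
      using congrArg P.dagger h.counit'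

theorem IsDaggerFrobenius.eval_eq {J : JunctionData P} {μ : Term 2 1} {ι : Term 0 1}
    (h : IsDaggerFrobenius P (J.eval μ) (J.eval ι)) {m n : ℕ} {s t : Term m n}
    (hst : FrobeniusEq μ ι μ.dagger ι.dagger s t) : J.eval s = J.eval t := by
  cases hst <;> simp only [JunctionData.eval, JunctionData.eval_dagger]
  case assoc => exact h.assoc
  case unit_left => exact h.unit_left
  case unit_right => exact h.unit_right
  case coassoc =>
    simpa only [P.dagger_comp, P.dagger_tensor, P.dagger_id]
      using congrArg P.dagger h.assoc
  case counit_left =>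
    simpa only [P.dagger_comp, P.dagger_tensor, P.dagger_id]
      using congrArg P.dagger h.unit_left
  case counit_right =>
    simpa only [P.dagger_comp, P.dagger_tensor, P.dagger_id]
      using congrArg P.dagger h.unit_right
  case frobenius_left => exact h.frobenius
  case frobenius_right =>
    simpa only [P.dagger_comp, P.dagger_tensor, P.dagger_id, P.dagger_dagger]
      using congrArg P.dagger h.frobenius
  case special => exact h.special
  case extra => exact h.extra
  case symmetric => exact h.symmetric
  case cosymmetric =>
    simpa only [P.dagger_comp, P.dagger_braid, P.dagger_dagger]
      using congrArg P.dagger h.symmetric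

theorem IsWeakBimonoid.eval_eq {J : JunctionData P} {μ : Term 2 1} {ι : Term 0 1} {δ : Term 1 2}
    {ε : Term 1 0} (h : IsWeakBimonoid P (J.eval μ) (J.eval ι) (J.eval δ) (J.eval ε)) {m n : ℕ}
    {s t : Term m n} (hst : WeakBimonoidEq μ ι δ ε s t) : J.eval s = J.eval t := by
  cases hst
  exacts [h.mul_comul, h.counit, h.counit', h.unit, h.unit']

namespace JunctionData

/-- The values with the two families of junctions exchanged. -/
def swap (J : JunctionData P) : JunctionData P where
  M := J.M'
  I := J.I'
  M' := J.M
  I' := J.I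

/-- The value of the endomorphism `M' ∘ D ∘ M ∘ D'`. -/
def loop (J : JunctionData P) : P.Hom 1 1 :=
  P.comp (P.comp (P.dagger J.M') J.M) (P.comp (P.dagger J.M) J.M')

/-- The defining equations of bond graphs, up to the dagger: of each pair of equations exchanged by
the dagger only one is recorded. -/
structure SatisfiesEquations (J : JunctionData P) : Prop where
  frobenius : IsDaggerFrobenius P J.M J.I
  frobenius' : IsDaggerFrobenius P J.M' J.I'
  weakBimonoid : IsWeakBimonoid P J.M J.I (P.dagger J.M') (P.dagger J.I')
  extra : P.comp J.I (P.dagger J.I') = P.id 0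
  idem : P.comp J.loop J.loop = J.loop
  idem' : P.comp J.swap.loop J.swap.loop = J.swap.loop

namespace SatisfiesEquations

theorem swap {J : JunctionData P} (hJ : J.SatisfiesEquations) : J.swap.SatisfiesEquations where
  frobenius := hJ.frobenius'
  frobenius' := hJ.frobenius
  weakBimonoid := by simpa only [JunctionData.swap, P.dagger_dagger] using hJ.weakBimonoid.dagger
  extra := by
    simpa only [JunctionData.swap, P.dagger_comp, P.dagger_dagger, P.dagger_id]
      using congrArg P.dagger hJ.extra
  idem := hJ.idem'
  idem' := hJ.idem

theorem isModel {J : JunctionData P} (hJ : J.SatisfiesEquations) : J.IsModel := by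
  intro m n s t h
  cases h with
  | frobenius _ _ h => exact IsDaggerFrobenius.eval_eq (μ := .M) (ι := .I) hJ.frobenius h
  | frobenius' _ _ h => exact IsDaggerFrobenius.eval_eq (μ := .M') (ι := .I') hJ.frobenius' h
  | weakBimonoid _ _ h => exact IsWeakBimonoid.eval_eq hJ.weakBimonoid h
  | weakBimonoid' _ _ h => exact IsWeakBimonoid.eval_eq hJ.swap.weakBimonoid h
  | extra => exact hJ.swap.extra
  | extra' => exact hJ.extra
  | idem => exact hJ.idem
  | idem' => exact hJ.idem'

end SatisfiesEquations

end JunctionData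

end FrobeniusMonoids

section Relations

variable {X : Type u}

theorem exists_fin_one_pi {p : (Fin 1 → X) → Prop} : (∃ z, p z) ↔ ∃ a, p ![a] := by
  rw [Fin.exists_fin_succ_pi]; simp only [Fin.exists_fin_zero_pi]; rfl

theorem exists_fin_two_pi {p : (Fin 2 → X) → Prop} : (∃ z, p z) ↔ ∃ a b, p ![a, b] := by
  rw [Fin.exists_fin_succ_pi]; simp only [exists_fin_one_pi]; rfl

theorem exists_fin_three_pi {p : (Fin 3 → X) → Prop} : (∃ z, p z) ↔ ∃ a b c, p ![a, b, c] := by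
  rw [Fin.exists_fin_succ_pi]; simp only [exists_fin_two_pi]; rfl

theorem exists_fin_four_pi {p : (Fin 4 → X) → Prop} :
    (∃ z, p z) ↔ ∃ a b c d, p ![a, b, c, d] := by
  rw [Fin.exists_fin_succ_pi]; simp only [exists_fin_three_pi]; rfl

/-- The relation from `X ^ 2` to `X` given by a ternary relation. -/
def ternaryRel (T : X → X → X → Prop) : (relProp X).Hom 2 1 := fun x y => T (x 0) (x 1) (y 0)

/-- The relation from `X ^ 0` to `X` given by a subset. -/
def unaryRel (U : X → Prop) : (relProp X).Hom 0 1 := fun _ y => U (y 0)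

theorem isDaggerFrobenius_ternaryRel {T : X → X → X → Prop} {U : X → Prop}
    (assoc : ∀ a b c d, (∃ e, T a b e ∧ T e c d) ↔ ∃ e, T b c e ∧ T a e d)
    (unit_left : ∀ a b, (∃ u, U u ∧ T u a b) ↔ a = b)
    (unit_right : ∀ a b, (∃ u, U u ∧ T a u b) ↔ a = b)
    (frobenius : ∀ a b c d, (∃ e, T c e a ∧ T e b d) ↔ ∃ e, T a b e ∧ T c d e)
    (special : ∀ a b, (∃ c d, T c d a ∧ T c d b) ↔ a = b) (extra : ∃ u, U u)
    (symmetric : ∀ a b, (∃ u, T b a u ∧ U u) ↔ ∃ u, T a b u ∧ U u) :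
    IsDaggerFrobenius (relProp X) (ternaryRel T) (unaryRel U) := by
  constructor
  all_goals
    funext x y
    try simp only [Nat.reduceAdd] at x y
    simp [relProp, relData, ternaryRel, unaryRel, exists_fin_one_pi, exists_fin_two_pi,
      exists_fin_three_pi, Fin.castAdd, Fin.natAdd, funext_iff, Fin.forall_fin_succ, *]

end Relations

section Groupoids

/-- A groupoid given by its set `X` of arrows and its set `B` of objects.  The product of arrows is
a total operation, whose value matters only for composable arrows. -/
structure ArrowGroupoid (X : Type u) (B : Type v) where
  src : X → B
  tgt : X → B
  one : B → X
  mul : X → X → X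
  inv : X → X
  src_one : ∀ b, src (one b) = b
  tgt_one : ∀ b, tgt (one b) = b
  src_mul : ∀ {f g}, tgt f = src g → src (mul f g) = src f
  tgt_mul : ∀ {f g}, tgt f = src g → tgt (mul f g) = tgt g
  src_inv : ∀ f, src (inv f) = tgt f
  tgt_inv : ∀ f, tgt (inv f) = src f
  one_mul : ∀ f, mul (one (src f)) f = f
  mul_one : ∀ f, mul f (one (tgt f)) = f
  mul_assoc : ∀ {f g h}, tgt f = src g → tgt g = src h → mul (mul f g) h = mul f (mul g h)
  mul_inv : ∀ f, mul f (inv f) = one (src f)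
  inv_mul : ∀ f, mul (inv f) f = one (tgt f)

namespace ArrowGroupoid

variable {X : Type u} {B : Type v}

/-- The arrows `f` and `g` are composable, with composite `h`. -/
def IsComp (G : ArrowGroupoid X B) (f g h : X) : Prop :=
  G.tgt f = G.src g ∧ h = G.mul f g

/-- The arrow `f` is an identity. -/
def IsOne (G : ArrowGroupoid X B) (f : X) : Prop :=
  f = G.one (G.src f)

/-- The groupoid with only identities. -/
def discrete (X : Type u) : ArrowGroupoid X X where
  src f := f
  tgt f := f
  one f := f
  mul f _ := f
  inv f := f
  src_one _ := rfl
  tgt_one _ := rfl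
  src_mul _ := rfl
  tgt_mul h := h
  src_inv _ := rfl
  tgt_inv _ := rfl
  one_mul _ := rfl
  mul_one _ := rfl
  mul_assoc _ _ := rfl
  mul_inv _ := rfl
  inv_mul _ := rfl

/-- The groupoid with exactly one arrow between any two elements of `A`, an arrow being the pair of
its source and its target. -/
def pair (A : Type u) : ArrowGroupoid (Fin 2 → A) A where
  src f := f 0
  tgt f := f 1
  one a := ![a, a]
  mul f g := ![f 0, g 1]
  inv f := ![f 1, f 0]
  src_one _ := rfl
  tgt_one _ := rfl
  src_mul _ := rfl
  tgt_mul _ := rfl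
  src_inv _ := rfl
  tgt_inv _ := rfl
  one_mul _ := List.ofFn_injective rfl
  mul_one _ := List.ofFn_injective rfl
  mul_assoc _ _ := rfl
  mul_inv _ := rfl
  inv_mul _ := rfl

/-- An additive group as a groupoid with one object. -/
def ofAddGroup (A : Type u) [AddGroup A] : ArrowGroupoid A Unit where
  src _ := ()
  tgt _ := ()
  one _ := 0
  mul f g := f + g
  inv f := -f
  src_one _ := rfl
  tgt_one _ := rfl
  src_mul _ := rfl
  tgt_mul _ := rfl
  src_inv _ := rfl
  tgt_inv _ := rfl
  one_mul := zero_add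
  mul_one := add_zero
  mul_assoc _ _ := add_assoc _ _ _
  mul_inv := add_neg_cancel
  inv_mul := neg_add_cancel

variable (G : ArrowGroupoid X B)

/-- Composition of arrows as a relation. -/
def mulRel : (relProp X).Hom 2 1 := ternaryRel G.IsComp

/-- The identities as a relation. -/
def unitRel : (relProp X).Hom 0 1 := unaryRel G.IsOne

variable {G}

theorem inv_mul_cancel_left {f g : X} (h : G.tgt f = G.src g) :
    G.mul (G.inv f) (G.mul f g) = g := by
  rw [← G.mul_assoc (G.tgt_inv f) h, G.inv_mul, h, G.one_mul]

theorem mul_inv_cancel_left {f g : X} (h : G.src f = G.src g) :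
    G.mul f (G.mul (G.inv f) g) = g := by
  rw [← G.mul_assoc (G.src_inv f).symm ((G.tgt_inv f).trans h), G.mul_inv, h, G.one_mul]

theorem eq_inv_of_mul_eq_one {f g : X} {b : B} (h : G.tgt f = G.src g)
    (h' : G.mul f g = G.one b) : g = G.inv f := by
  have hb : b = G.tgt (G.inv f) := by
    rw [G.tgt_inv, ← G.src_mul h, h', G.src_one]
  rw [← inv_mul_cancel_left h, h', hb, G.mul_one]

variable (G)

attribute [local grind =] src_one tgt_one src_mul tgt_mul tgt_inv one_mul mul_one mul_assoc
  inv_mul inv_mul_cancel_left mul_inv_cancel_left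

theorem isDaggerFrobenius [Nonempty B] : IsDaggerFrobenius (relProp X) G.mulRel G.unitRel := by
  apply isDaggerFrobenius_ternaryRel <;> simp only [IsComp, IsOne]
  case assoc => grind
  case unit_left =>
    refine fun a b => ⟨by grind, ?_⟩
    rintro rfl
    exact ⟨G.one (G.src a), by grind⟩
  case unit_right =>
    refine fun a b => ⟨by grind, ?_⟩
    rintro rfl
    exact ⟨G.one (G.tgt a), by grind⟩
  case frobenius =>
    refine fun a b c d => ⟨by grind, ?_⟩
    rintro ⟨_, ⟨h, rfl⟩, h', h''⟩
    have : G.src a = G.src c := by rw [← G.src_mul h, h'', G.src_mul h']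
    exact ⟨G.mul (G.inv c) a, by grind⟩
  case special =>
    refine fun a b => ⟨by grind, ?_⟩
    rintro rfl
    exact ⟨G.one (G.src a), a, by grind⟩
  case extra => exact Nonempty.elim ‹_› fun b => ⟨G.one b, by grind⟩
  case symmetric =>
    have (a b : X) (h : ∃ u, (G.tgt b = G.src a ∧ u = G.mul b a) ∧ u = G.one (G.src u)) :
        ∃ u, (G.tgt a = G.src b ∧ u = G.mul a b) ∧ u = G.one (G.src u) := by
      obtain ⟨_, ⟨h, rfl⟩, h'⟩ := h
      obtain rfl := eq_inv_of_mul_eq_one h h'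
      exact ⟨G.mul (G.inv b) b, by grind⟩
    exact fun a b => ⟨this a b, this b a⟩

theorem isWeakBimonoid_copy {T : X → X → X → Prop} {U : X → Prop}
    (mul_unique : ∀ {a b c c'}, T a b c → T a b c' → c = c')
    (composable : ∀ a b c, (∃ e, T a b e ∧ ∃ f, T e c f) ↔ (∃ e, T a b e) ∧ ∃ e, T b c e)
    (unit : ∀ {a b c}, U a → U c → (T a c b ↔ a = b ∧ c = b)) :
    IsWeakBimonoid (relProp X) (ternaryRel T) (unaryRel U)
      ((relProp X).dagger (discrete X).mulRel) ((relProp X).dagger (discrete X).unitRel) := by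
  constructor
  all_goals
    funext x y
    try simp only [Nat.reduceAdd] at x y
    simp only [relProp, relData, mulRel, ternaryRel, unitRel, unaryRel, IsComp, IsOne, discrete,
      exists_fin_one_pi, exists_fin_two_pi, exists_fin_four_pi, funext_iff, Fin.forall_fin_succ,
      Fin.castAdd, Fin.natAdd, Fin.castLE_zero, Fin.castLE_succ, Fin.reduceCastLE, Fin.isValue,
      Fin.val_eq_zero, Fin.coe_ofNat_eq_mod, Fin.mk_one, Fin.reduceFinMk, Nat.zero_mod,
      Nat.mod_succ, Nat.add_zero, add_zero, Nat.reduceAdd, Matrix.cons_val_zero,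
      Matrix.cons_val_one, Matrix.cons_val, Matrix.cons_val_fin_one, ↓existsAndEq,
      exists_eq_left', exists_eq_right, exists_eq_right_right, IsEmpty.forall_iff, and_true,
      true_and, eq_iff_iff, composable]
  all_goals grind

theorem isWeakBimonoid : IsWeakBimonoid (relProp X) G.mulRel G.unitRel
    ((relProp X).dagger (discrete X).mulRel) ((relProp X).dagger (discrete X).unitRel) := by
  apply isWeakBimonoid_copy <;> simp only [IsComp, IsOne]
  case mul_unique => grind
  case composable => grind
  case unit => grind

/-- The relations on the arrows of a groupoid in which the 1-junctions compose and the 0-junctions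
copy arrows. -/
def junctions : JunctionData (relProp X) where
  M := G.mulRel
  I := G.unitRel
  M' := (discrete X).mulRel
  I' := (discrete X).unitRel

theorem loop_junctions (x y : Fin 1 → X) :
    G.junctions.loop x y ↔ ∃ f, G.IsComp (x 0) (x 0) f ∧ G.IsComp (y 0) (y 0) f := by
  simp [JunctionData.loop, relProp, relData, junctions, mulRel, ternaryRel, exists_fin_one_pi,
    exists_fin_two_pi, IsComp, discrete]

theorem loop_swap_junctions (x y : Fin 1 → X) :
    G.junctions.swap.loop x y ↔ x = y ∧ ∃ f, G.IsComp f f (x 0) := by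
  simp only [JunctionData.loop, relProp, relData, JunctionData.swap, junctions, mulRel, ternaryRel,
    IsComp, discrete, exists_fin_one_pi, exists_fin_two_pi, Matrix.cons_val_zero,
    Matrix.cons_val_one, Matrix.cons_val_fin_one, ↓existsAndEq, true_and, exists_eq_left',
    exists_eq_right', funext_iff, Fin.forall_fin_one]
  grind

theorem satisfiesEquations_junctions [Nonempty B] : G.junctions.SatisfiesEquations where
  frobenius := G.isDaggerFrobenius
  frobenius' :=
    have : Nonempty X := .map G.one ‹_›
    (discrete X).isDaggerFrobenius
  weakBimonoid := G.isWeakBimonoid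
  extra := by
    funext x y
    have : ∃ f, G.IsOne f ∧ (discrete X).IsOne f :=
      Nonempty.elim ‹_› fun b => ⟨G.one b, by simp only [IsOne, G.src_one], rfl⟩
    simpa [relProp, relData, junctions, unitRel, unaryRel, exists_fin_one_pi,
      Subsingleton.elim x y]
  idem := by
    funext x y
    change (∃ z, G.junctions.loop x z ∧ G.junctions.loop z y) = G.junctions.loop x y
    simp only [loop_junctions, IsComp]
    grind
  idem' := by
    funext x y
    change (∃ z, G.junctions.swap.loop x z ∧ G.junctions.swap.loop z y) =
      G.junctions.swap.loop x y
    simp only [loop_swap_junctions]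
    grind

end ArrowGroupoid

end Groupoids

section Products

variable {A : Type u} {B : Type v}

/-- The product of relations on `A` and on `B`, as a relation on `A × B`. -/
def prodRel {m n : ℕ} (R : (relProp A).Hom m n) (S : (relProp B).Hom m n) :
    (relProp (A × B)).Hom m n :=
  fun x y => R (Prod.fst ∘ x) (Prod.fst ∘ y) ∧ S (Prod.snd ∘ x) (Prod.snd ∘ y)

theorem prodRel_id (n : ℕ) :
    prodRel ((relProp A).id n) ((relProp B).id n) = (relProp (A × B)).id n := by
  funext x y
  simp only [prodRel, relProp, relData, funext_iff, Function.comp_apply, Prod.ext_iff, forall_and]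

theorem prodRel_comp {m n p : ℕ} (R : (relProp A).Hom m n) (R' : (relProp A).Hom n p)
    (S : (relProp B).Hom m n) (S' : (relProp B).Hom n p) :
    prodRel ((relProp A).comp R R') ((relProp B).comp S S') =
      (relProp (A × B)).comp (prodRel R S) (prodRel R' S') := by
  funext x z
  refine propext ⟨?_, ?_⟩
  · rintro ⟨⟨y, hR, hR'⟩, y', hS, hS'⟩
    exact ⟨fun i => (y i, y' i), ⟨hR, hS⟩, hR', hS'⟩
  · rintro ⟨y, ⟨hR, hS⟩, hR', hS'⟩
    exact ⟨⟨_, hR, hR'⟩, _, hS, hS'⟩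

theorem prodRel_tensor {m n p q : ℕ} (R : (relProp A).Hom m n) (R' : (relProp A).Hom p q)
    (S : (relProp B).Hom m n) (S' : (relProp B).Hom p q) :
    prodRel ((relProp A).tensor R R') ((relProp B).tensor S S') =
      (relProp (A × B)).tensor (prodRel R S) (prodRel R' S') :=
  funext₂ fun _ _ => propext and_and_and_comm

theorem prodRel_braid (m n : ℕ) :
    prodRel ((relProp A).braid m n) ((relProp B).braid m n) = (relProp (A × B)).braid m n := by
  funext x y
  simp only [prodRel, relProp, relData, Function.comp_apply, Prod.ext_iff, forall_and,
    and_and_and_comm]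

namespace JunctionData

/-- The product of values of the generators in relations. -/
def prod (J : JunctionData (relProp A)) (K : JunctionData (relProp B)) :
    JunctionData (relProp (A × B)) where
  M := prodRel J.M K.M
  I := prodRel J.I K.I
  M' := prodRel J.M' K.M'
  I' := prodRel J.I' K.I'

theorem eval_prod (J : JunctionData (relProp A)) (K : JunctionData (relProp B)) {m n : ℕ}
    (t : Term m n) : (J.prod K).eval t = prodRel (J.eval t) (K.eval t) := by
  induction t with
  | gen j => cases j <;> rfl
  | ident n => exact (prodRel_id n).symm
  | comp s t hs ht => simp only [eval, prodRel_comp, hs, ht]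
  | tensor s t hs ht => simp only [eval, prodRel_tensor, hs, ht]
  | braid m n => exact (prodRel_braid m n).symm

theorem IsModel.prod {J : JunctionData (relProp A)} {K : JunctionData (relProp B)}
    (hJ : J.IsModel) (hK : K.IsModel) : (J.prod K).IsModel := by
  intro m n s t h
  rw [eval_prod, eval_prod, hJ h, hK h]

end JunctionData

end Products

section LagrangianRelations

variable {k : Type u} [Field k]

/-- A linear relation between powers of `k` as a relation. -/
def linRel {m n : ℕ} (R : Submodule k ((Fin m → k) × (Fin n → k))) : (relProp k).Hom m n :=
  fun x y => (x, y) ∈ R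

variable (k)

theorem linRel_addRel : linRel (addRel k) = (ArrowGroupoid.ofAddGroup k).mulRel :=
  funext₂ fun _ _ => propext (and_iff_right rfl).symm

theorem linRel_zeroRel : linRel (zeroRel k) = (ArrowGroupoid.ofAddGroup k).unitRel :=
  rfl

theorem linRel_linDagger_dupRel :
    linRel (linDagger (dupRel k)) = (ArrowGroupoid.discrete k).mulRel := by
  funext x y
  change (x 0 = y 0 ∧ x 1 = y 0) = (x 0 = x 1 ∧ y 0 = x 0)
  grind

theorem linRel_linDagger_delRel :
    linRel (linDagger (delRel k)) = (ArrowGroupoid.discrete k).unitRel :=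
  funext₂ fun _ _ => propext (iff_of_true trivial rfl)

/-- A morphism of `LagRelO k` as a relation. -/
def LagRelO.toRel : DaggerPropHom (LagRelO k) (relProp (k × k)) :=
  ((LagRel k).subIncl (IsLagGen k) (isLagGen_dagger k)).comp (LagRel.toRel k)

theorem LagRelO.toRel_faithful : (LagRelO.toRel k).Faithful :=
  ((LagRel k).subIncl_faithful _ _).comp (LagRel.toRel_faithful k)

/-- The values in `LagRelO k` of the generators of `BondGraph`. -/
def LagRelO.junctions : JunctionData (LagRelO k) :=
  ⟨addDup k, zeroDel k, dupAdd k, delZero k⟩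

theorem LagRelO.map_toRel_junctions : (junctions k).map (toRel k) =
    (ArrowGroupoid.ofAddGroup k).junctions.prod (ArrowGroupoid.ofAddGroup k).junctions.swap := by
  ext1
  · exact congrArg₂ prodRel (linRel_addRel k) (linRel_linDagger_dupRel k)
  · exact congrArg₂ prodRel (linRel_zeroRel k) (linRel_linDagger_delRel k)
  · exact congrArg₂ prodRel (linRel_linDagger_dupRel k) (linRel_addRel k)
  · exact congrArg₂ prodRel (linRel_linDagger_delRel k) (linRel_zeroRel k)

theorem LagRelO.isModel_junctions : (junctions k).IsModel := by
  have h := (ArrowGroupoid.ofAddGroup k).satisfiesEquations_junctions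
  apply JunctionData.IsModel.of_map (toRel_faithful k)
  rw [map_toRel_junctions]
  exact h.isModel.prod h.swap.isModel

end LagrangianRelations

section MultiplesOfRelations

variable {A : Type u}

/-- The tuple of length `c * n` formed by the entries of `n` tuples of length `c`. -/
def flatten {c n : ℕ} : (Fin n → Fin c → A) ≃ (Fin (c * n) → A) :=
  (Equiv.curry _ _ _).symm.trans
    (Equiv.arrowCongr (finProdFinEquiv.trans (finCongr (Nat.mul_comm n c))) (Equiv.refl A))

theorem flatten_castAdd {c m n : ℕ} (x : Fin (m + n) → Fin c → A) (i : Fin (c * m)) :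
    flatten x (Fin.cast (Nat.mul_add c m n).symm (Fin.castAdd (c * n) i)) =
      flatten (fun j => x (Fin.castAdd n j)) i :=
  rfl

theorem flatten_natAdd {c m n : ℕ} (x : Fin (m + n) → Fin c → A) (i : Fin (c * n)) :
    flatten x (Fin.cast (Nat.mul_add c m n).symm (Fin.natAdd (c * m) i)) =
      flatten (fun j => x (Fin.natAdd m j)) i := by
  have hc : 0 < c := Nat.pos_of_mul_pos_right i.pos
  refine congrArg₂ x (Fin.ext ?_) (Fin.ext ?_)
  · exact Nat.mul_add_div hc m i
  · exact Nat.mul_add_mod c m i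

theorem forall_flatten_eq_iff {c n : ℕ} {x y : Fin n → Fin c → A} :
    (∀ i, flatten x i = flatten y i) ↔ ∀ j, x j = y j := by
  rw [← funext_iff, flatten.injective.eq_iff, funext_iff]

variable (A)

/-- A relation between tuples whose lengths are multiples of `c`, as a relation between tuples of
elements of `Fin c → A`. -/
def relProp.blocks (c : ℕ) : DaggerPropHom ((relProp A).multiples c) (relProp (Fin c → A)) where
  map R x y := R (flatten x) (flatten y)
  map_id _ := funext₂ fun _ _ => propext flatten.injective.eq_iff
  map_comp R S := funext₂ fun x y => propext <|
    flatten.surjective.exists (p := fun z => R (flatten x) z ∧ S z (flatten y))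
  map_tensor R S := by
    refine (funext₂ fun x y => congrFun₂ (relData_cast _ _ _) _ _).trans ?_
    funext x y
    refine congrArg₂ And rfl (congrArg₂ S ?_ ?_)
    · exact funext (flatten_natAdd x)
    · exact funext (flatten_natAdd y)
  map_braid m n := by
    refine (funext₂ fun x y => congrFun₂ (relData_cast _ _ _) _ _).trans ?_
    funext x y
    refine congrArg₂ And (propext ?_) (propext ?_)
    · exact (forall_congr' fun i => Eq.congr (flatten_castAdd x i) (flatten_natAdd y i)).trans
        forall_flatten_eq_iff
    · exact (forall_congr' fun i => Eq.congr (flatten_natAdd x i) (flatten_castAdd y i)).trans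
        forall_flatten_eq_iff
  map_dagger _ := rfl

theorem relProp.blocks_faithful (c : ℕ) : (blocks A c).Faithful := by
  intro m n R S h
  funext x y
  rw [← flatten.apply_symm_apply x, ← flatten.apply_symm_apply y]
  exact congrFun₂ h _ _

end MultiplesOfRelations

section Corelations

theorem finCorelInv_top {m n : ℕ} (x : Fin m → Prop) (y : Fin n → Prop) :
    finCorelInv ⊤ x y ↔ ∀ a b, Sum.elim x y a = Sum.elim x y b :=
  ⟨fun h a b => h (x := a) (y := b) trivial, fun h _ _ _ => h _ _⟩

namespace FinCorel

theorem toRel_corM : toRel.map corM = fun x y => x 0 = y 0 ∧ x 1 = y 0 := by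
  funext x y
  refine propext ((finCorelInv_top x y).trans ?_)
  simp only [Sum.forall, Fin.forall_fin_succ, Fin.forall_fin_zero, Sum.elim_inl, Sum.elim_inr]
  grind

theorem toRel_corI : toRel.map corI = fun _ _ => True := by
  funext x y
  refine propext ((finCorelInv_top x y).trans ?_)
  simp [Fin.forall_fin_succ]

theorem toRel_corD : toRel.map corD = fun x y => y 0 = x 0 ∧ y 1 = x 0 :=
  (toRel.map_dagger corM).trans (congrArg (relProp Prop).dagger toRel_corM)

theorem toRel_corE : toRel.map corE = fun _ _ => True :=
  (toRel.map_dagger corI).trans (congrArg (relProp Prop).dagger toRel_corI)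

theorem toRel_corM₂ : toRel.map corM₂ = fun x y => (x 0 = y 0 ∧ x 2 = x 1) ∧ x 3 = y 1 := by
  simp only [corM₂, toRel.map_tensor, toRel.map_comp, toRel.map_id, toRel_corM, toRel_corE]
  simp [-eq_iff_iff, relProp, relData, funext_iff, Fin.forall_fin_succ, exists_fin_one_pi,
    Fin.castAdd, Fin.natAdd]

theorem toRel_corI₂ : toRel.map corI₂ = fun _ y => y 0 = y 1 := by
  simp only [corI₂, toRel.map_comp, toRel_corI, toRel_corD]
  simp [-eq_iff_iff, relProp, relData, exists_fin_one_pi, eq_comm]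

theorem toRel_corMu₂ :
    toRel.map corMu₂ = fun x y => (x 0 = y 0 ∧ x 2 = y 0) ∧ x 1 = y 1 ∧ x 3 = y 1 := by
  simp only [corMu₂, corSwap, toRel.map_tensor, toRel.map_comp, toRel.map_id, toRel.map_braid,
    toRel_corM]
  simp [-eq_iff_iff, relProp, relData, funext_iff, Fin.forall_fin_succ, exists_fin_four_pi,
    Fin.castAdd, Fin.natAdd]

theorem toRel_corIota₂ : toRel.map corIota₂ = fun _ _ => True := by
  simp only [corIota₂, toRel.map_tensor, toRel_corI]
  simp [relProp, relData]

end FinCorel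

namespace FinCorelO

/-- A morphism of `FinCorelO` as a relation between families of pairs of truth values. -/
def toRel : DaggerPropHom FinCorelO (relProp (Fin 2 → Prop)) :=
  (((FinCorel.multiples 2).subIncl IsCorelGen isCorelGen_dagger).comp
    (FinCorel.toRel.multiples 2)).comp (relProp.blocks Prop 2)

theorem toRel_faithful : toRel.Faithful :=
  (((FinCorel.multiples 2).subIncl_faithful _ _).comp
    (FinCorel.toRel_faithful.multiples 2)).comp (relProp.blocks_faithful Prop 2)

/-- The values in `FinCorelO` of the generators of `BondGraph`. -/
def junctions : JunctionData FinCorelO :=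
  ⟨m₂, i₂, μ₂, ι₂⟩

theorem map_toRel_junctions : junctions.map toRel = (ArrowGroupoid.pair Prop).junctions := by
  ext1 <;> funext x y
  · refine (congrFun₂ FinCorel.toRel_corM₂ (flatten x) (flatten y)).trans ?_
    change ((x 0 0 = y 0 0 ∧ x 1 0 = x 0 1) ∧ x 1 1 = y 0 1) =
      (x 0 1 = x 1 0 ∧ y 0 = ![x 0 0, x 1 1])
    simp only [funext_iff, Fin.forall_fin_two, Matrix.cons_val_zero, Matrix.cons_val_one]
    grind
  · refine (congrFun₂ FinCorel.toRel_corI₂ (flatten x) (flatten y)).trans ?_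
    change (y 0 0 = y 0 1) = (y 0 = ![y 0 0, y 0 0])
    simp only [funext_iff, Fin.forall_fin_two, Matrix.cons_val_zero, Matrix.cons_val_one]
    grind
  · refine (congrFun₂ FinCorel.toRel_corMu₂ (flatten x) (flatten y)).trans ?_
    change ((x 0 0 = y 0 0 ∧ x 1 0 = y 0 0) ∧ x 0 1 = y 0 1 ∧ x 1 1 = y 0 1) =
      (x 0 = x 1 ∧ y 0 = x 0)
    simp only [funext_iff, Fin.forall_fin_two]
    grind
  · refine (congrFun₂ FinCorel.toRel_corIota₂ (flatten x) (flatten y)).trans ?_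
    exact (eq_true rfl).symm

theorem isModel_junctions : junctions.IsModel := by
  apply JunctionData.IsModel.of_map toRel_faithful
  rw [map_toRel_junctions]
  exact (ArrowGroupoid.pair Prop).satisfiesEquations_junctions.isModel

end FinCorelO

end Corelations

end BondGraphs

theorem mainTheorem7 (k : Type*) [Field k] :
    (∃! G : BondGraphs.DaggerPropHom BondGraphs.BondGraph BondGraphs.FinCorelO,
      G.map (BondGraphs.BondGraph.of .M) = BondGraphs.FinCorelO.m₂ ∧
      G.map (BondGraphs.BondGraph.of .I) = BondGraphs.FinCorelO.i₂ ∧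
      G.map (BondGraphs.BondGraph.of .M') = BondGraphs.FinCorelO.μ₂ ∧
      G.map (BondGraphs.BondGraph.of .I') = BondGraphs.FinCorelO.ι₂) ∧
    (∃! F : BondGraphs.DaggerPropHom BondGraphs.BondGraph (BondGraphs.LagRelO k),
      F.map (BondGraphs.BondGraph.of .M) = BondGraphs.LagRelO.addDup k ∧
      F.map (BondGraphs.BondGraph.of .I) = BondGraphs.LagRelO.zeroDel k ∧
      F.map (BondGraphs.BondGraph.of .M') = BondGraphs.LagRelO.dupAdd k ∧
      F.map (BondGraphs.BondGraph.of .I') = BondGraphs.LagRelO.delZero k) :=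
  ⟨(existsUnique_congr fun _ => BondGraphs.JunctionData.ext_iff).1
      BondGraphs.FinCorelO.isModel_junctions.existsUnique_hom,
    (existsUnique_congr fun _ => BondGraphs.JunctionData.ext_iff).1
      (BondGraphs.LagRelO.isModel_junctions k).existsUnique_hom⟩
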